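/- Let $k$ be a field and let $\underline Z:\Delta\to\mathbf{Top}$ be a cosimplicial topological space. Let $\underline\Delta$ be the cosimplicial space $[p]\mapsto\Delta^p$ of standard simplices, and let $\|\underline Z\|$ be the set of maps of cosimplicial spaces $\underline\Delta\to\underline Z$ with the topology induced by $\|\underline Z\|\subset\prod_p \mathbf{Top}(\Delta^p,\underline Z[p])$. Let $e_p:\Delta^p\times\|\underline Z\|\to\underline Z[p]$ be the evaluation map. For a space $X$ let $C^*(X)$ be the differential graded algebra of singular cochains with coefficients in $k$, with $(\delta\alpha)(\sigma)=\sum_i(-1)^i\alpha(d_i\sigma)$ and the cup product $(\alpha\cup\beta)(\sigma)=\alpha(\text{front face})\,\beta(\text{back face})$, and let $N^*(X)\subset C^*(X)$ be the subalgebra of normalized cochains, those which vanish on degenerate singular simplices. For fixed $q$, $p\mapsto N^q(\underline Z[p])$ is a simplicial vector space. Let $N_pN^q(\underline Z)$ be the quotient of $N^q(\underline Z[p])$ by the span of the images of the degeneracy operators, with the differentials $\partial=\sum_i(-1)^id_i:N_pN^q\to N_{p-1}N^q$ and $\delta:N_pN^q\to N_pN^{q+1}$. Let $$|NC(\underline Z)|^n=\bigoplus_{q-p=n}N_pN^q(\underline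 Z),\qquad d=(-1)^p(\delta-\partial)\ \text{ on } N_pN^q(\underline Z),$$ with the product of the classes of $x\in N^r(\underline Z[p])$ and $y\in N^s(\underline Z[q])$ equal to the class of $$(-1)^{q(r-p)}\sum_{(\mu,\nu)}(-1)^{\epsilon(\mu)}\, s_\nu x\cup s_\mu y\ \in N^{r+s}(\underline Z[p+q]),$$ where the sum is over the $(p,q)$-shuffles $(\mu,\nu)$ and $(-1)^{\epsilon(\mu)}$ is the signature of the shuffle. For $x\in N^{p+s}(\underline Z[p])$ let $\phi(x)\in C^s(\|\underline Z\|)$ be the slant product of $C^*(e_p)(x)\in C^{p+s}(\Delta^p\times\|\underline Z\|)$ with the fundamental simplex $\iota_p=\mathrm{id}_{\Delta^p}$, that is $\langle\phi(x),w\rangle=\langle C^*(e_p)(x),EZ(\iota_p\otimes w)\rangle$ for all singular $s$-simplices $w$ of $\|\underline Z\|$, where $EZ$ is the Eilenberg–Zilber shuffle map; and let $\phi=0$ on $N_pN^q(\underline Z)$ for $q<p$. Then $|NC(\underline Z)|^*$ and $C^*(\|\underline Z\|)$ are $\mathbf Z$-graded associative unital differential algebras; $\phi$ is well defined on the quotients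 $N_pN^q(\underline Z)$, takes values in $N^*(\|\underline Z\|)$, and is a morphism of differential graded algebras $$\phi:|NC(\underline Z)|^*\longrightarrow N^*(\|\underline Z\|)\subset C^*(\|\underline Z\|):$$ it preserves degrees and units, commutes with the differentials and satisfies $\phi(x\cdot y)=\phi(x)\cup\phi(y)$. Moreover $\phi$ is natural in $\underline Z$. -/

import Mathlib

open CategoryTheory Simplicial Opposite
open scoped DirectSum

universe u v w

namespace BenderskyGitler

/-! ### Differential graded algebras -/

section DGA

variable (k : Type v) [Field k]

/-- The raw data of a `ℤ`-graded differential algebra over `k`: the underlying module (the direct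
sum of all degrees), the submodules of homogeneous elements, differential, product and unit. -/
structure DGData where
  carrier : Type w
  [addCommGroup : AddCommGroup carrier]
  [module : Module k carrier]
  /-- the homogeneous elements of a given degree -/
  deg : ℤ → Submodule k carrier
  /-- the differential -/
  d : carrier →ₗ[k] carrier
  /-- the product -/
  mul : carrier →ₗ[k] carrier →ₗ[k] carrier
  /-- the unit -/
  one : carrier

attribute [instance] DGData.addCommGroup DGData.module

variable {k}

/-- The axioms of a (cohomologically) `ℤ`-graded, associative, unital differential algebra. -/
structure DGData.IsDGAlgebra (A : DGData.{v, w} k) : Prop where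
  isInternal : DirectSum.IsInternal A.deg
  one_mem : A.one ∈ A.deg 0
  mul_mem : ∀ m n x y, x ∈ A.deg m → y ∈ A.deg n → A.mul x y ∈ A.deg (m + n)
  d_mem : ∀ n x, x ∈ A.deg n → A.d x ∈ A.deg (n + 1)
  one_mul : ∀ x, A.mul A.one x = x
  mul_one : ∀ x, A.mul x A.one = x
  mul_assoc : ∀ x y z, A.mul (A.mul x y) z = A.mul x (A.mul y z)
  d_d : ∀ x, A.d (A.d x) = 0
  leibniz : ∀ n x y, x ∈ A.deg n →
    A.d (A.mul x y) = A.mul (A.d x) y + n.negOnePow • A.mul x (A.d y)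

/-- A linear map which is a morphism of differential graded algebras. -/
structure IsDGHom {A B : DGData k} (f : A.carrier →ₗ[k] B.carrier) : Prop where
  map_deg : ∀ n x, x ∈ A.deg n → f x ∈ B.deg n
  map_d : ∀ x, f (A.d x) = B.d (f x)
  map_mul : ∀ x y, f (A.mul x y) = B.mul (f x) (f y)
  map_one : f A.one = B.one

end DGA

/-! ### Monotone maps and shuffles -/

lemma exists_adjacent {n m : ℕ} (f : ⦋n⦌ ⟶ ⦋m⦌) (hf : ¬ Function.Injective f) :
    ∃ j : Fin n, f j.castSucc = f j.succ := by
  by_contra! h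
  apply hf
  have hm : StrictMono (f : Fin (n + 1) → Fin (m + 1)) :=
    Fin.strictMono_iff_lt_succ.2 fun j =>
      lt_of_le_of_ne (f.toOrderHom.monotone (Fin.castSucc_lt_succ (i := j)).le) (h j)
  exact hm.injective

lemma δ_comp_σ_not_injective {n : ℕ} (i : Fin (n + 2)) (j : Fin (n + 1))
    (h1 : i ≠ j.castSucc) (h2 : i ≠ j.succ) :
    ¬ Function.Injective (SimplexCategory.δ i ≫ SimplexCategory.σ j : ⦋n⦌ ⟶ ⦋n⦌) := by
  obtain ⟨a, ha⟩ := Fin.exists_succAbove_eq h1.symm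
  obtain ⟨b, hb⟩ := Fin.exists_succAbove_eq h2.symm
  intro hinj
  have hab : a = b := hinj (by
    change j.predAbove (i.succAbove a) = j.predAbove (i.succAbove b)
    rw [ha, hb, Fin.predAbove_castSucc_self, Fin.predAbove_succ_self])
  rw [hab, hb] at ha
  simp [Fin.ext_iff] at ha

lemma alternating_sum_mem {k : Type v} [Field k] {M : Type w} [AddCommGroup M] [Module k M]
    (S : Submodule k M) {n : ℕ} (g : (⦋n⦌ ⟶ ⦋n⦌) → M)
    (hg : ∀ f : ⦋n⦌ ⟶ ⦋n⦌, ¬ Function.Injective f → g f ∈ S) (j : Fin (n + 1)) :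
    ∑ i : Fin (n + 2), (-1 : k) ^ (i : ℕ) • g (SimplexCategory.δ i ≫ SimplexCategory.σ j) ∈ S := by
  have hne : j.castSucc ≠ j.succ := by simp [Fin.ext_iff]
  rw [← Finset.add_sum_erase _ _ (Finset.mem_univ j.castSucc),
    ← Finset.add_sum_erase _ _ (Finset.mem_erase.2 ⟨hne.symm, Finset.mem_univ j.succ⟩),
    SimplexCategory.δ_comp_σ_self, SimplexCategory.δ_comp_σ_succ, ← add_assoc]
  refine S.add_mem ?_ (S.sum_mem fun i hi => S.smul_mem _ (hg _ ?_))
  · rw [Fin.val_castSucc, Fin.val_succ, pow_succ, mul_neg_one, neg_smul, add_neg_cancel]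
    exact S.zero_mem
  · simp only [Finset.mem_erase] at hi
    exact δ_comp_σ_not_injective i j hi.2.1 hi.1

/-- The monotone map `[n] → [p]`, `i ↦ #{m ∈ μ | m < i}`: it goes up by one from `m` to `m + 1`
when `m ∈ μ`, and collapses `m` and `m + 1` to one point when `m ∉ μ`. -/
def climb {n p : ℕ} (μ : Finset (Fin n)) (h : μ.card = p) : ⦋n⦌ ⟶ ⦋p⦌ :=
  SimplexCategory.mkHom
    { toFun := fun i => ⟨(μ.filter fun m => m.castSucc < i).card,
        Nat.lt_succ_of_le ((Finset.card_filter_le _ _).trans h.le)⟩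
      monotone' := fun _ _ hij => Finset.card_le_card
        (Finset.monotone_filter_right _ fun _ _ hm => lt_of_lt_of_le hm hij) }

lemma climb_apply_val {n p : ℕ} (μ : Finset (Fin n)) (h : μ.card = p) (i : Fin (n + 1)) :
    (climb μ h i : Fin (p + 1)).val = (μ.filter fun m => m.castSucc < i).card := rfl

lemma climb_succ {n p : ℕ} (μ : Finset (Fin n)) (h : μ.card = p) (t : Fin n) :
    (climb μ h t.succ : Fin (p + 1)).val =
      (climb μ h t.castSucc : Fin (p + 1)).val + if t ∈ μ then 1 else 0 := by
  rw [climb_apply_val, climb_apply_val]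
  have h1 : (μ.filter fun m => m.castSucc < t.succ) =
      (μ.filter fun m => m.castSucc < t.castSucc) ∪ (μ.filter fun m => m = t) := by
    ext m
    simp only [Finset.mem_filter, Finset.mem_union, Fin.lt_def, Fin.val_castSucc, Fin.val_succ,
      Fin.ext_iff]
    constructor
    · rintro ⟨a, b⟩
      rcases Nat.lt_succ_iff_lt_or_eq.1 b with b | b
      · exact Or.inl ⟨a, b⟩
      · exact Or.inr ⟨a, b⟩
    · rintro (⟨a, b⟩ | ⟨a, b⟩)
      · exact ⟨a, by omega⟩
      · exact ⟨a, by omega⟩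
  rw [h1, Finset.card_union_of_disjoint, Finset.filter_eq']
  · split_ifs <;> simp
  · rw [Finset.disjoint_filter]
    rintro m - hm rfl
    exact lt_irrefl _ hm

lemma exists_climb_step {n p : ℕ} (μ : Finset (Fin n)) (h : μ.card = p) (j : Fin p) :
    ∃ t ∈ μ, (climb μ h t.castSucc : Fin (p + 1)) = j.castSucc ∧
      (climb μ h t.succ : Fin (p + 1)) = j.succ := by
  by_contra! hc
  have key : ∀ i : Fin (n + 1), (climb μ h i : Fin (p + 1)).val ≤ j.val := by
    intro i
    induction i using Fin.induction with
    | zero =>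
      rw [climb_apply_val]
      simp
    | succ t ih =>
      have h1 := climb_succ μ h t
      by_cases ht : t ∈ μ
      · have h2 := hc t ht
        simp only [Fin.ext_iff, Fin.val_castSucc] at h2
        rw [if_pos ht] at h1
        rcases Nat.lt_or_eq_of_le ih with h3 | h3
        · omega
        · exact absurd (Fin.ext (by rw [h1, h3, Fin.val_succ])) (h2 h3)
      · rw [if_neg ht] at h1
        omega
  have hl := key (Fin.last n)
  rw [climb_apply_val, Finset.filter_true_of_mem (fun m _ => Fin.castSucc_lt_last m), h] at hl
  exact absurd j.isLt (by omega)

lemma climb_flat {n p : ℕ} (μ : Finset (Fin n)) (h : μ.card = p) {t : Fin n} (ht : t ∉ μ) :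
    (climb μ h t.castSucc : Fin (p + 1)) = climb μ h t.succ := by
  have := climb_succ μ h t
  rw [if_neg ht] at this
  exact Fin.ext (by omega)

/-- A `(p, q)`-shuffle, that is a partition of `{0, …, n - 1}` into a part `μ` with `p` elements
and a part `ν` with `q` elements (there is none unless `n = p + q`). -/
structure Shuffle (p q n : ℕ) where
  /-- the part `μ₁ < ⋯ < μ_p` -/
  μ : Finset (Fin n)
  card_μ : μ.card = p
  card_ν : μᶜ.card = q

namespace Shuffle

variable {p q n : ℕ}

lemma μ_injective : Function.Injective (Shuffle.μ : Shuffle p q n → Finset (Fin n)) := by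
  rintro ⟨a, _, _⟩ ⟨b, _, _⟩ h
  cases h
  rfl

noncomputable instance : Fintype (Shuffle p q n) := Fintype.ofInjective _ μ_injective

/-- The monotone surjection `[n] → [p]` which inserts the degeneracies indexed by `ν`. -/
def left (s : Shuffle p q n) : ⦋n⦌ ⟶ ⦋p⦌ := climb s.μ s.card_μ

/-- The monotone surjection `[n] → [q]` which inserts the degeneracies indexed by `μ`. -/
def right (s : Shuffle p q n) : ⦋n⦌ ⟶ ⦋q⦌ := climb s.μᶜ s.card_ν

/-- The exponent `∑ i, (μ_i - i)` of the signature: the number of pairs `(m, l)` with `m ∈ μ`,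
`l ∈ ν` and `l < m`. -/
def inversions (s : Shuffle p q n) : ℕ :=
  ((s.μ ×ˢ s.μᶜ).filter fun ml => ml.2 < ml.1).card

end Shuffle

/-! ### Cochains of simplicial sets -/

section Cochain

variable (k : Type v) [Field k]

/-- The `k`-valued `n`-cochains of a simplicial set. -/
abbrev Cochain (K : SSet.{u}) (n : ℕ) : Type (max u v) := K _⦋n⦌ → k

/-- The coboundary `(δ α) σ = ∑ i, (-1)^i α (d_i σ)`. -/
def coboundary (K : SSet.{u}) (n : ℕ) : Cochain k K n →ₗ[k] Cochain k K (n + 1) where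
  toFun α σ := ∑ i : Fin (n + 2), (-1 : k) ^ (i : ℕ) * α (K.δ i σ)
  map_add' α β := by
    funext σ
    simp [mul_add, Finset.sum_add_distrib]
  map_smul' c α := by
    funext σ
    simp [Finset.mul_sum, mul_left_comm]

/-- The front `p`-face of a `(p + q)`-simplex. -/
def front (p q : ℕ) : ⦋p⦌ ⟶ ⦋p + q⦌ := SimplexCategory.subinterval 0 p (by omega)

/-- The back `q`-face of a `(p + q)`-simplex. -/
def back (p q : ℕ) : ⦋q⦌ ⟶ ⦋p + q⦌ := SimplexCategory.subinterval p q le_rfl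

/-- The cup product: `(α ∪ β) σ` is the product of the values of `α` on the front face and of `β`
on the back face of `σ`. -/
def cup (K : SSet.{u}) (p q : ℕ) :
    Cochain k K p →ₗ[k] Cochain k K q →ₗ[k] Cochain k K (p + q) :=
  LinearMap.mk₂ k
    (fun α β σ => α (K.map (front p q).op σ) * β (K.map (back p q).op σ))
    (fun _ _ _ => by funext σ; simp [add_mul])
    (fun _ _ _ => by funext σ; simp [mul_assoc])
    (fun _ _ _ => by funext σ; simp [mul_add])
    (fun _ _ _ => by funext σ; simp [mul_left_comm])

/-- The normalized cochains: those which vanish on all degenerate simplices. -/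
def normalized (K : SSet.{u}) (n : ℕ) : Submodule k (Cochain k K n) where
  carrier := {α | ∀ σ ∈ K.degenerate n, α σ = 0}
  add_mem' ha hb σ hσ := by simp [ha σ hσ, hb σ hσ]
  zero_mem' _ _ := rfl
  smul_mem' c α ha σ hσ := by simp [ha σ hσ]

/-- The map induced on cochains by a simplicial map. -/
def pullback {K L : SSet.{u}} (f : K ⟶ L) (n : ℕ) : Cochain k L n →ₗ[k] Cochain k K n where
  toFun α σ := α (f.app _ σ)
  map_add' _ _ := rfl
  map_smul' _ _ := rfl

variable {k}

lemma map_mem_degenerate (K : SSet.{u}) {n m : ℕ} (f : ⦋n⦌ ⟶ ⦋m⦌)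
    (hf : ¬ Function.Injective f) (σ : K _⦋m⦌) : K.map f.op σ ∈ K.degenerate n := by
  obtain ⟨j, hj⟩ := exists_adjacent f hf
  cases n with
  | zero => exact j.elim0
  | succ n =>
    obtain ⟨g, rfl⟩ := SimplexCategory.eq_σ_comp_of_not_injective' f j hj
    exact ⟨n, by omega, SimplexCategory.σ j, K.map g.op σ, by simp⟩

lemma exists_adjacent_of_mem_degenerate (K : SSet.{u}) {n : ℕ} {σ : K _⦋n⦌}
    (hσ : σ ∈ K.degenerate n) :
    ∃ (m : ℕ) (f : ⦋n⦌ ⟶ ⦋m⦌) (τ : K _⦋m⦌) (j : Fin n),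
      σ = K.map f.op τ ∧ f j.castSucc = f j.succ := by
  obtain ⟨m, hm, f, τ, rfl⟩ := hσ
  have hf : ¬ Function.Injective f := fun h => by
    have := Fintype.card_le_of_injective (f : Fin (n + 1) → Fin (m + 1)) h
    simp at this
    omega
  obtain ⟨j, hj⟩ := exists_adjacent f hf
  exact ⟨m, f, τ, j, rfl, hj⟩

lemma pullback_mem {K L : SSet.{u}} (f : K ⟶ L) {n : ℕ} {α : Cochain k L n}
    (hα : α ∈ normalized k L n) : pullback k f n α ∈ normalized k K n :=
  fun _ hσ => hα _ (SSet.degenerate_app_apply hσ f)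

lemma cup_mem {K : SSet.{u}} {p q : ℕ} {α : Cochain k K p} {β : Cochain k K q}
    (hα : α ∈ normalized k K p) (hβ : β ∈ normalized k K q) :
    cup k K p q α β ∈ normalized k K (p + q) := by
  intro σ hσ
  obtain ⟨m, f, τ, j, rfl, hj⟩ := exists_adjacent_of_mem_degenerate K hσ
  change α _ * β _ = 0
  by_cases h : j.val < p
  · rw [hα, zero_mul]
    rw [← Functor.map_comp_apply, ← op_comp]
    apply map_mem_degenerate
    intro hinj
    have := @hinj (⟨j.val, by omega⟩ : Fin (p + 1)) (⟨j.val + 1, by omega⟩ : Fin (p + 1)) hj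
    simp [Fin.ext_iff] at this
  · rw [hβ, mul_zero]
    rw [← Functor.map_comp_apply, ← op_comp]
    apply map_mem_degenerate
    intro hinj
    have hlt := j.isLt
    have := @hinj (⟨j.val - p, by omega⟩ : Fin (q + 1)) (⟨j.val - p + 1, by omega⟩ : Fin (q + 1)) (by
      have e1 : back p q (⟨j.val - p, by omega⟩ : Fin (q + 1)) = j.castSucc :=
        Fin.ext (by change j.val - p + p = j.val; omega)
      have e2 : back p q (⟨j.val - p + 1, by omega⟩ : Fin (q + 1)) = j.succ :=
        Fin.ext (by change j.val - p + 1 + p = j.val + 1; omega)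
      change f (back p q _) = f (back p q _)
      rw [e1, e2]
      exact hj)
    simp [Fin.ext_iff] at this

lemma coboundary_mem {K : SSet.{u}} {n : ℕ} {α : Cochain k K n}
    (hα : α ∈ normalized k K n) : coboundary k K n α ∈ normalized k K (n + 1) := by
  intro σ hσ
  rw [SSet.degenerate_eq_iUnion_range_σ] at hσ
  simp only [Set.mem_iUnion, Set.mem_range] at hσ
  obtain ⟨j, τ, rfl⟩ := hσ
  have h := alternating_sum_mem (⊥ : Submodule k k)
    (fun f : ⦋n⦌ ⟶ ⦋n⦌ => α (K.map f.op τ))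
    (fun f hf => hα _ (map_mem_degenerate K f hf τ)) j
  rw [Submodule.mem_bot] at h
  change ∑ i : Fin (n + 2), (-1 : k) ^ (i : ℕ) * α (K.δ i (K.σ j τ)) = 0
  refine Eq.trans (Finset.sum_congr rfl fun i _ => ?_) h
  rw [smul_eq_mul, op_comp, Functor.map_comp_apply]
  rfl

end Cochain

/-! ### The differential graded algebra of singular cochains -/

section Singular

variable (k : Type v) [Field k]

/-- The singular cochain algebra `C^*(X)` of a space. -/
noncomputable def singularCochains (X : TopCat.{u}) : DGData.{v, max u v} k where
  carrier := ⨁ n : ℕ, Cochain k (TopCat.toSSet.obj X) n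
  deg m := ⨆ (n : ℕ) (_ : (n : ℤ) = m),
    LinearMap.range (DirectSum.lof k ℕ (fun n => Cochain k (TopCat.toSSet.obj X) n) n)
  d := DirectSum.toModule k ℕ _ fun n =>
    DirectSum.lof k ℕ (fun n => Cochain k (TopCat.toSSet.obj X) n) (n + 1) ∘ₗ coboundary k _ n
  mul := DirectSum.toModule k ℕ _ fun p => LinearMap.flip <| DirectSum.toModule k ℕ _ fun q =>
    LinearMap.flip <| (cup k _ p q).compr₂
      (DirectSum.lof k ℕ (fun n => Cochain k (TopCat.toSSet.obj X) n) (p + q))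
  one := DirectSum.lof k ℕ (fun n => Cochain k (TopCat.toSSet.obj X) n) 0 fun _ => 1

/-- The submodule `N^*(X)` of normalized singular cochains in `C^*(X)`. -/
noncomputable def normalizedSingularCochains (X : TopCat.{u}) :
    Submodule k (singularCochains k X).carrier :=
  ⨆ n : ℕ, (normalized k (TopCat.toSSet.obj X) n).map
    (DirectSum.lof k ℕ (fun n => Cochain k (TopCat.toSSet.obj X) n) n)

variable {X Y : TopCat.{u}}

/-- The map `C^*(Y) → C^*(X)` induced by a continuous map `X → Y`. -/
noncomputable def singularCochains.map (f : X ⟶ Y) :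
    (singularCochains k Y).carrier →ₗ[k] (singularCochains k X).carrier :=
  DirectSum.toModule k ℕ _ fun n =>
    DirectSum.lof k ℕ (fun n => Cochain k (TopCat.toSSet.obj X) n) n ∘ₗ
      pullback k (TopCat.toSSet.map f) n

end Singular

/-! ### The cochain algebra of a cosimplicial space -/

section Realization

variable (k : Type v) [Field k] (Z : SimplexCategory ⥤ TopCat.{u})

/-- The normalized singular `q`-cochains of `Z[p]`. -/
noncomputable abbrev NC (p q : ℕ) : Submodule k (Cochain k (TopCat.toSSet.obj (Z.obj ⦋p⦌)) q) :=
  normalized k (TopCat.toSSet.obj (Z.obj ⦋p⦌)) q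

/-- The simplicial structure on `p ↦ N^q(Z[p])`. -/
noncomputable def NC.act {p p' : ℕ} (f : ⦋p⦌ ⟶ ⦋p'⦌) (q : ℕ) : NC k Z p' q →ₗ[k] NC k Z p q :=
  (pullback k (TopCat.toSSet.map (Z.map f)) q).restrict fun _ h => pullback_mem _ h

/-- The subspace `D_p N^q(Z)` spanned by the images of the degeneracy operators. -/
noncomputable def NC.D (p q : ℕ) : Submodule k (NC k Z p q) :=
  match p with
  | 0 => ⊥
  | _ + 1 => ⨆ j, LinearMap.range (NC.act k Z (SimplexCategory.σ j) q)

/-- The normalized chains `N_p N^q(Z)` of the simplicial vector space `p ↦ N^q(Z[p])`. -/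
def NN (p q : ℕ) : Type (max u v) := NC k Z p q ⧸ NC.D k Z p q

noncomputable instance (p q : ℕ) : AddCommGroup (NN k Z p q) :=
  inferInstanceAs (AddCommGroup (NC k Z p q ⧸ NC.D k Z p q))

noncomputable instance (p q : ℕ) : Module k (NN k Z p q) :=
  inferInstanceAs (Module k (NC k Z p q ⧸ NC.D k Z p q))

/-- The class of a normalized cochain of `Z[p]` in `N_p N^q(Z)`. -/
noncomputable def NN.mk (p q : ℕ) : NC k Z p q →ₗ[k] NN k Z p q := (NC.D k Z p q).mkQ

/-- The alternating sum of the faces. -/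
noncomputable def NC.face (p q : ℕ) : NC k Z (p + 1) q →ₗ[k] NC k Z p q :=
  ∑ i : Fin (p + 2), (-1 : k) ^ (i : ℕ) • NC.act k Z (SimplexCategory.δ i) q

/-- The coboundary of `N^*(Z[p])`. -/
noncomputable def NC.coboundary (p q : ℕ) : NC k Z p q →ₗ[k] NC k Z p (q + 1) :=
  (BenderskyGitler.coboundary k (TopCat.toSSet.obj (Z.obj ⦋p⦌)) q).restrict
    fun _ h => coboundary_mem h

/-- The cup product of `N^*(Z[p])`. -/
noncomputable def NC.cup (p r s : ℕ) : NC k Z p r →ₗ[k] NC k Z p s →ₗ[k] NC k Z p (r + s) :=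
  LinearMap.mk₂ k
    (fun x y => ⟨BenderskyGitler.cup k (TopCat.toSSet.obj (Z.obj ⦋p⦌)) r s x y,
      cup_mem x.2 y.2⟩)
    (fun _ _ _ => by ext1; simp) (fun _ _ _ => by ext1; simp)
    (fun _ _ _ => by ext1; simp) (fun _ _ _ => by ext1; simp)

/-- The shuffle product `x ⊗ y ↦ ∑ (-1)^ε(μ) (s_ν x) ∪ (s_μ y)`. -/
noncomputable def NC.shuffle (p r q s : ℕ) :
    NC k Z p r →ₗ[k] NC k Z q s →ₗ[k] NC k Z (p + q) (r + s) :=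
  ∑ h : Shuffle p q (p + q), (-1 : k) ^ h.inversions •
    (NC.cup k Z (p + q) r s).compl₁₂ (NC.act k Z h.left r) (NC.act k Z h.right s)

variable {k Z}

lemma NC.act_comp {p p' p'' : ℕ} (f : ⦋p⦌ ⟶ ⦋p'⦌) (g : ⦋p'⦌ ⟶ ⦋p''⦌) (q : ℕ) (x : NC k Z p'' q) :
    NC.act k Z (f ≫ g) q x = NC.act k Z f q (NC.act k Z g q x) := by
  ext σ
  change x.1 ((TopCat.toSSet.map (Z.map (f ≫ g))).app _ σ) = _
  rw [Functor.map_comp, Functor.map_comp]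
  rfl

lemma NC.act_mem_D {p p' : ℕ} (f : ⦋p⦌ ⟶ ⦋p'⦌) (hf : ¬ Function.Injective f) (q : ℕ)
    (x : NC k Z p' q) : NC.act k Z f q x ∈ NC.D k Z p q := by
  obtain ⟨j, hj⟩ := exists_adjacent f hf
  cases p with
  | zero => exact j.elim0
  | succ p =>
    obtain ⟨g, rfl⟩ := SimplexCategory.eq_σ_comp_of_not_injective' f j hj
    rw [NC.act_comp]
    exact Submodule.mem_iSup_of_mem j ⟨_, rfl⟩

/-- Induction principle for inclusions of `D_p N^q(Z)`. -/
lemma NC.D_le {p q : ℕ} (S : Submodule k (NC k Z p q))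
    (h : ∀ (p' : ℕ) (f : ⦋p⦌ ⟶ ⦋p'⦌) (j : Fin p), f j.castSucc = f j.succ →
      ∀ x, NC.act k Z f q x ∈ S) : NC.D k Z p q ≤ S := by
  cases p with
  | zero => exact bot_le
  | succ p =>
    refine iSup_le fun j => ?_
    rintro _ ⟨x, rfl⟩
    refine h p (SimplexCategory.σ j) j ?_ x
    change j.predAbove j.castSucc = j.predAbove j.succ
    rw [Fin.predAbove_castSucc_self, Fin.predAbove_succ_self]

lemma NC.face_D (p q : ℕ) :
    NC.D k Z (p + 1) q ≤ (NC.D k Z p q).comap (NC.face k Z p q) := by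
  refine iSup_le fun j => ?_
  rintro _ ⟨x, rfl⟩
  have h := alternating_sum_mem (NC.D k Z p q) (fun f => NC.act k Z f q x)
    (fun f hf => NC.act_mem_D f hf q x) j
  simp only [NC.act_comp] at h
  simpa [NC.face] using h

lemma NC.coboundary_D (p q : ℕ) :
    NC.D k Z p q ≤ (NC.D k Z p (q + 1)).comap (NC.coboundary k Z p q) := by
  refine NC.D_le _ fun p' f j hj x => ?_
  have h : NC.coboundary k Z p q (NC.act k Z f q x) =
      NC.act k Z f (q + 1) (NC.coboundary k Z p' q x) := by
    ext σ
    rfl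
  rw [Submodule.mem_comap, h]
  exact NC.act_mem_D f (fun hf => absurd (hf hj) (by simp [Fin.ext_iff])) _ _

lemma NC.cup_act {p p' : ℕ} (f : ⦋p⦌ ⟶ ⦋p'⦌) {r s : ℕ} (x : NC k Z p' r) (y : NC k Z p' s) :
    NC.cup k Z p r s (NC.act k Z f r x) (NC.act k Z f s y) =
      NC.act k Z f (r + s) (NC.cup k Z p' r s x y) := by
  ext σ
  rfl

/-- A cup product is degenerate as soon as its two factors are degenerate at the same place. -/
lemma NC.cup_mem_D {n p q r s : ℕ} (f : ⦋n⦌ ⟶ ⦋p⦌) (g : ⦋n⦌ ⟶ ⦋q⦌) (t : Fin n)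
    (hf : f t.castSucc = f t.succ) (hg : g t.castSucc = g t.succ)
    (x : NC k Z p r) (y : NC k Z q s) :
    NC.cup k Z n r s (NC.act k Z f r x) (NC.act k Z g s y) ∈ NC.D k Z n (r + s) := by
  cases n with
  | zero => exact t.elim0
  | succ n =>
    obtain ⟨f, rfl⟩ := SimplexCategory.eq_σ_comp_of_not_injective' f t hf
    obtain ⟨g, rfl⟩ := SimplexCategory.eq_σ_comp_of_not_injective' g t hg
    rw [NC.act_comp, NC.act_comp, NC.cup_act]
    exact Submodule.mem_iSup_of_mem t ⟨_, rfl⟩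

lemma NC.shuffle_apply {p r q s : ℕ} (x : NC k Z p r) (y : NC k Z q s) :
    NC.shuffle k Z p r q s x y = ∑ h : Shuffle p q (p + q), (-1 : k) ^ h.inversions •
      NC.cup k Z (p + q) r s (NC.act k Z h.left r x) (NC.act k Z h.right s y) := by
  simp [NC.shuffle, LinearMap.sum_apply]

lemma NC.shuffle_D_left (p r q s : ℕ) {x : NC k Z p r} (hx : x ∈ NC.D k Z p r)
    (y : NC k Z q s) : NC.shuffle k Z p r q s x y ∈ NC.D k Z (p + q) (r + s) := by
  refine NC.D_le ((NC.D k Z (p + q) (r + s)).comap ((NC.shuffle k Z p r q s).flip y))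
    (fun p' f j hj x => ?_) hx
  rw [Submodule.mem_comap, LinearMap.flip_apply, NC.shuffle_apply]
  refine Submodule.sum_mem _ fun h _ => Submodule.smul_mem _ _ ?_
  obtain ⟨t, ht, h1, h2⟩ := exists_climb_step h.μ h.card_μ j
  rw [← NC.act_comp]
  refine NC.cup_mem_D _ _ t ?_ (climb_flat _ _ (by simpa using ht)) _ _
  change f (h.left t.castSucc) = f (h.left t.succ)
  rw [Shuffle.left, h1, h2, hj]

lemma NC.shuffle_D_right (p r q s : ℕ) (x : NC k Z p r) {y : NC k Z q s}
    (hy : y ∈ NC.D k Z q s) : NC.shuffle k Z p r q s x y ∈ NC.D k Z (p + q) (r + s) := by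
  refine NC.D_le ((NC.D k Z (p + q) (r + s)).comap (NC.shuffle k Z p r q s x))
    (fun p' f j hj y => ?_) hy
  rw [Submodule.mem_comap, NC.shuffle_apply]
  refine Submodule.sum_mem _ fun h _ => Submodule.smul_mem _ _ ?_
  obtain ⟨t, ht, h1, h2⟩ := exists_climb_step h.μᶜ h.card_ν j
  rw [← NC.act_comp]
  refine NC.cup_mem_D _ _ t (climb_flat _ _ (by simpa using ht)) ?_ _ _
  change f (h.right t.castSucc) = f (h.right t.succ)
  rw [Shuffle.right, h1, h2, hj]

variable (k Z)

variable {k Z} in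
/-- The linear map on `N_p N^q(Z)` induced by a linear map which vanishes on `D_p N^q(Z)`. -/
noncomputable def NN.lift {p q : ℕ} {M : Type w} [AddCommGroup M] [Module k M]
    (f : NC k Z p q →ₗ[k] M) (hf : ∀ x ∈ NC.D k Z p q, f x = 0) : NN k Z p q →ₗ[k] M :=
  Submodule.liftQ (NC.D k Z p q) f hf

variable {k Z} in
lemma NN.lift_mk {p q : ℕ} {M : Type w} [AddCommGroup M] [Module k M]
    (f : NC k Z p q →ₗ[k] M) (hf : ∀ x ∈ NC.D k Z p q, f x = 0) (x : NC k Z p q) :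
    NN.lift f hf (NN.mk k Z p q x) = f x := rfl

variable {k Z} in
lemma NN.mk_eq_zero {p q : ℕ} {x : NC k Z p q} (hx : x ∈ NC.D k Z p q) :
    NN.mk k Z p q x = 0 :=
  (Submodule.Quotient.mk_eq_zero _).2 hx

variable {k Z} in
lemma NN.mk_surjective (p q : ℕ) : Function.Surjective (NN.mk k Z p q) :=
  Submodule.mkQ_surjective _

/-- The differential `δ : N_p N^q(Z) → N_p N^{q+1}(Z)` induced by the coboundary. -/
noncomputable def NN.coboundary (p q : ℕ) : NN k Z p q →ₗ[k] NN k Z p (q + 1) :=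
  NN.lift (NN.mk k Z p (q + 1) ∘ₗ NC.coboundary k Z p q)
    fun _ hx => NN.mk_eq_zero (NC.coboundary_D p q hx)

/-- The differential `∂ : N_{p+1} N^q(Z) → N_p N^q(Z)` induced by the faces. -/
noncomputable def NN.face (p q : ℕ) : NN k Z (p + 1) q →ₗ[k] NN k Z p q :=
  NN.lift (NN.mk k Z p q ∘ₗ NC.face k Z p q) fun _ hx => NN.mk_eq_zero (NC.face_D p q hx)

/-- The shuffle product induced on normalized chains. -/
noncomputable def NN.shuffle (p r q s : ℕ) :
    NN k Z p r →ₗ[k] NN k Z q s →ₗ[k] NN k Z (p + q) (r + s) :=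
  NN.lift
    (LinearMap.flip <| NN.lift
      ((NC.shuffle k Z p r q s).compr₂ (NN.mk k Z (p + q) (r + s))).flip fun y hy =>
        LinearMap.ext fun x => NN.mk_eq_zero (NC.shuffle_D_right p r q s x hy))
    fun x hx => LinearMap.ext fun y => by
      obtain ⟨y, rfl⟩ := NN.mk_surjective q s y
      exact NN.mk_eq_zero (NC.shuffle_D_left p r q s hx y)

lemma NN.shuffle_mk (p r q s : ℕ) (x : NC k Z p r) (y : NC k Z q s) :
    NN.shuffle k Z p r q s (NN.mk k Z p r x) (NN.mk k Z q s y) =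
      NN.mk k Z (p + q) (r + s) (NC.shuffle k Z p r q s x y) := rfl

/-- The underlying module of `|NN(Z)|^*`, the direct sum of all the `N_p N^q(Z)`. -/
abbrev RealizationModule : Type (max u v) := ⨁ i : ℕ × ℕ, NN k Z i.1 i.2

/-- The inclusion of the summand `N_p N^q(Z)` in `|NN(Z)|^*`. -/
noncomputable abbrev NN.incl (p q : ℕ) : NN k Z p q →ₗ[k] RealizationModule k Z :=
  DirectSum.lof k (ℕ × ℕ) (fun i => NN k Z i.1 i.2) (p, q)

/-- The horizontal part of the differential on the summand `N_p N^q(Z)`. -/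
noncomputable def NN.faceTotal (p q : ℕ) : NN k Z p q →ₗ[k] RealizationModule k Z :=
  match p with
  | 0 => 0
  | p + 1 => NN.incl k Z p q ∘ₗ NN.face k Z p q

/-- The algebra `|NN(Z)|^*` of normalized cochains on the cosimplicial space `Z`. The summand
`N_p N^q(Z)` is in degree `q - p`, the differential is `(-1)^p (δ - ∂)` on it, and the product of
`x ∈ N_p N^r(Z)` and `y ∈ N_q N^s(Z)` is the shuffle product with the Koszul sign
`(-1)^{q (r - p)}`. -/
noncomputable def realization : DGData.{v, max u v} k where
  carrier := RealizationModule k Z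
  deg n := ⨆ (i : ℕ × ℕ) (_ : (i.2 : ℤ) - (i.1 : ℤ) = n), LinearMap.range (NN.incl k Z i.1 i.2)
  d := DirectSum.toModule k (ℕ × ℕ) _ fun i =>
    (-1 : k) ^ i.1 • (NN.incl k Z i.1 (i.2 + 1) ∘ₗ NN.coboundary k Z i.1 i.2 -
      NN.faceTotal k Z i.1 i.2)
  mul := DirectSum.toModule k (ℕ × ℕ) _ fun i => LinearMap.flip <|
    DirectSum.toModule k (ℕ × ℕ) _ fun j => LinearMap.flip <|
      ((j.1 : ℤ) * ((i.2 : ℤ) - (i.1 : ℤ))).negOnePow •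
        (NN.shuffle k Z i.1 i.2 j.1 j.2).compr₂ (NN.incl k Z (i.1 + j.1) (i.2 + j.2))
  one := NN.incl k Z 0 0 (NN.mk k Z 0 0 ⟨fun _ => 1, fun σ hσ => by simp at hσ⟩)

variable {k Z} {W : SimplexCategory ⥤ TopCat.{u}}

/-- The map on normalized cochains of `Z[p]` induced by a map of cosimplicial spaces. -/
noncomputable def NC.map (f : Z ⟶ W) (p q : ℕ) : NC k W p q →ₗ[k] NC k Z p q :=
  (pullback k (TopCat.toSSet.map (f.app ⦋p⦌)) q).restrict fun _ h => pullback_mem _ h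

lemma NC.map_D (f : Z ⟶ W) (p q : ℕ) {x : NC k W p q} (hx : x ∈ NC.D k W p q) :
    NC.map f p q x ∈ NC.D k Z p q := by
  refine NC.D_le ((NC.D k Z p q).comap (NC.map f p q)) (fun p' g j hj x => ?_) hx
  have h : NC.map f p q (NC.act k W g q x) = NC.act k Z g q (NC.map f p' q x) := by
    ext σ
    change x.1 ((TopCat.toSSet.map (W.map g)).app _ ((TopCat.toSSet.map (f.app ⦋p⦌)).app _ σ)) =
      x.1 ((TopCat.toSSet.map (f.app ⦋p'⦌)).app _ ((TopCat.toSSet.map (Z.map g)).app _ σ))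
    rw [← NatTrans.comp_app_apply, ← NatTrans.comp_app_apply, ← Functor.map_comp,
      ← Functor.map_comp, f.naturality]
  rw [Submodule.mem_comap, h]
  exact NC.act_mem_D g (fun hg => absurd (hg hj) (by simp [Fin.ext_iff])) _ _

/-- The map `|NN(W)|^* → |NN(Z)|^*` induced by a map of cosimplicial spaces `Z → W`. -/
noncomputable def realization.map (f : Z ⟶ W) :
    (realization k W).carrier →ₗ[k] (realization k Z).carrier :=
  DirectSum.toModule k (ℕ × ℕ) _ fun i => NN.incl k Z i.1 i.2 ∘ₗ
    NN.lift (NN.mk k Z i.1 i.2 ∘ₗ NC.map f i.1 i.2) fun _ hx => NN.mk_eq_zero (NC.map_D f _ _ hx)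

end Realization

/-! ### Geometric realization of a cosimplicial space and evaluation maps -/

section Evaluation

variable (Z : SimplexCategory ⥤ TopCat.{u})

/-- The maps of cosimplicial spaces from the cosimplicial space of standard simplices to `Z`. -/
noncomputable def Tot : Type u := SimplexCategory.toTop.{u} ⟶ Z

/-- The components of a point of `Tot Z`. -/
noncomputable def Tot.components (θ : Tot Z) (n : SimplexCategory) : C(SimplexCategory.toTop.{u}.obj n, Z.obj n) :=
  (NatTrans.app θ n).hom

/-- `Tot Z` carries the topology induced by its inclusion into the product of the mapping spaces
`C(Δ^n, Z[n])` with their compact-open topologies. -/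
noncomputable instance : TopologicalSpace (Tot Z) :=
  TopologicalSpace.induced (Tot.components Z) inferInstance

lemma Tot.continuous_components : Continuous (Tot.components Z) := continuous_induced_dom

/-- The geometric realization `‖Z‖` of a cosimplicial space. -/
noncomputable abbrev geometricRealization : TopCat.{u} := TopCat.of (Tot Z)

instance (n : SimplexCategory) : LocallyCompactSpace (SimplexCategory.toTop.{u}.obj n) :=
  inferInstanceAs (LocallyCompactSpace (ULift (stdSimplex ℝ (Fin (n.len + 1)))))

/-- The evaluation map `e_p : Δ^p × ‖Z‖ → Z[p]`. -/
noncomputable def evaluation (p : ℕ) :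
    TopCat.of (SimplexCategory.toTop.{u}.obj ⦋p⦌ × geometricRealization Z) ⟶ Z.obj ⦋p⦌ :=
  TopCat.ofHom
    { toFun := fun a => Tot.components Z a.2 ⦋p⦌ a.1
      continuous_toFun := by
        have h : Continuous fun θ : Tot Z => Tot.components Z θ ⦋p⦌ :=
          (continuous_apply _).comp (Tot.continuous_components Z)
        exact (h.comp continuous_snd).eval continuous_fst }

variable {Z} {W : SimplexCategory ⥤ TopCat.{u}}

/-- The map `‖Z‖ → ‖W‖` induced by a map of cosimplicial spaces. -/
noncomputable def geometricRealization.map (f : Z ⟶ W) : geometricRealization Z ⟶ geometricRealization W :=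
  TopCat.ofHom
    { toFun := fun θ : Tot Z => (CategoryStruct.comp θ f : SimplexCategory.toTop.{u} ⟶ W)
      continuous_toFun := continuous_induced_rng.2 <| continuous_pi fun n =>
        (ContinuousMap.continuous_postcomp (f.app n).hom).comp
          ((continuous_apply n).comp (Tot.continuous_components Z)) }

end Evaluation

/-! ### Slant product and the comparison map -/

section Slant

variable (k : Type v) [Field k] {X Y : TopCat.{u}}

/-- The singular simplex of `X × Y` with given components. -/
noncomputable def prodSimplex {n : ℕ} (σ : TopCat.toSSet.obj X _⦋n⦌)
    (τ : TopCat.toSSet.obj Y _⦋n⦌) : TopCat.toSSet.obj (TopCat.of (X × Y)) _⦋n⦌ :=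
  ⟨TopCat.ofHom (σ.down.hom.prodMk τ.down.hom)⟩

/-- The Eilenberg–Zilber shuffle chain `EZ(z ⊗ x) = ∑ (-1)^ε(μ) (s_ν z, s_μ x)` of a `p`-simplex
`z` of `X` and an `s`-simplex `x` of `Y`, a chain of dimension `n = p + s` of `X × Y` (it is `0`
for `n ≠ p + s`). -/
noncomputable def eilenbergZilber {p s : ℕ} (n : ℕ) (z : TopCat.toSSet.obj X _⦋p⦌)
    (x : TopCat.toSSet.obj Y _⦋s⦌) : TopCat.toSSet.obj (TopCat.of (X × Y)) _⦋n⦌ →₀ k :=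
  ∑ h : Shuffle p s n, Finsupp.single
    (prodSimplex ((TopCat.toSSet.obj X).map h.left.op z) ((TopCat.toSSet.obj Y).map h.right.op x))
    ((-1 : k) ^ h.inversions)

/-- The duality pairing `⟨α, c⟩` of an `n`-cochain with an `n`-chain. -/
noncomputable def pairing {K : SSet.{u}} {n : ℕ} (α : Cochain k K n) (c : K _⦋n⦌ →₀ k) : k :=
  c.sum fun σ a => a * α σ

/-- The slant product `α ↦ α / z`, `⟨α / z, x⟩ = ⟨α, EZ(z ⊗ x)⟩`, with a `p`-simplex `z`, from
`n`-cochains of `X × Y` to `s`-cochains of `Y`, where `n = p + s`. -/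
noncomputable def slant {p : ℕ} (n s : ℕ) (z : TopCat.toSSet.obj X _⦋p⦌) :
    Cochain k (TopCat.toSSet.obj (TopCat.of (X × Y))) n →ₗ[k] Cochain k (TopCat.toSSet.obj Y) s :=
  { toFun := fun α x => pairing k α (eilenbergZilber k n z x)
    map_add' := fun α β => by
      funext x
      simp [pairing, Finsupp.sum, mul_add, Finset.sum_add_distrib]
    map_smul' := fun c α => by
      funext x
      simp [pairing, Finsupp.sum, Finset.mul_sum, mul_left_comm] }

/-- The fundamental simplex `ι_p`, the identity of `Δ^p`. -/
noncomputable def fundamentalSimplex (p : ℕ) :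
    TopCat.toSSet.obj (SimplexCategory.toTop.{u}.obj ⦋p⦌) _⦋p⦌ := ⟨𝟙 _⟩

variable {k} in
lemma slant_apply {p n s : ℕ} (z : TopCat.toSSet.obj X _⦋p⦌)
    (α : Cochain k (TopCat.toSSet.obj (TopCat.of (X × Y))) n) (x : TopCat.toSSet.obj Y _⦋s⦌) :
    slant k n s z α x = ∑ h : Shuffle p s n, (-1 : k) ^ h.inversions *
      α (prodSimplex ((TopCat.toSSet.obj X).map h.left.op z)
        ((TopCat.toSSet.obj Y).map h.right.op x)) := by
  classical
  change pairing k α (eilenbergZilber k n z x) = _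
  rw [eilenbergZilber, pairing, ← Finsupp.sum_finsetSum_index (by simp) (by simp [add_mul])]
  simp

variable (Z : SimplexCategory ⥤ TopCat.{u})

/-- The composite of the map `C^q(e_p)` with the slant product by `ι_p`; it has values in the
cochains of degree `q - p` (and it is `0` for `q < p`, where there are no `(p, q - p)`-shuffles). -/
noncomputable def NC.integrate (p q : ℕ) :
    NC k Z p q →ₗ[k] Cochain k (TopCat.toSSet.obj (geometricRealization Z)) (q - p) :=
  slant k q (q - p) (fundamentalSimplex p) ∘ₗ
    pullback k (TopCat.toSSet.map (evaluation Z p)) q ∘ₗ (NC k Z p q).subtype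

variable {k Z}

lemma evaluation_simplex {n p p' : ℕ} (g : ⦋n⦌ ⟶ ⦋p⦌) (f : ⦋p⦌ ⟶ ⦋p'⦌)
    (w : TopCat.toSSet.obj (geometricRealization Z) _⦋n⦌) :
    (TopCat.toSSet.map (Z.map f)).app (op ⦋n⦌) ((TopCat.toSSet.map (evaluation Z p)).app (op ⦋n⦌)
      (prodSimplex ((TopCat.toSSet.obj _).map g.op (fundamentalSimplex p)) w)) =
    (TopCat.toSSet.map (evaluation Z p')).app (op ⦋n⦌)
      (prodSimplex ((TopCat.toSSet.obj _).map (g ≫ f).op (fundamentalSimplex p')) w) := by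
  apply ULift.ext
  apply TopCat.hom_ext
  ext t
  let w' : SimplexCategory.toTop.{u}.obj ⦋n⦌ ⟶ geometricRealization Z := w.down
  let θ : Tot Z := w'.hom t
  have h := NatTrans.naturality (θ : SimplexCategory.toTop.{u} ⟶ Z) f
  have h' := congrArg (fun a => a.hom (SimplexCategory.toTop.{u}.map g t)) h
  change (Z.map f).hom (Tot.components Z θ ⦋p⦌ (SimplexCategory.toTop.{u}.map g t)) =
    Tot.components Z θ ⦋p'⦌ (SimplexCategory.toTop.{u}.map (g ≫ f) t)
  rw [Functor.map_comp]
  exact h'.symm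

lemma NC.integrate_D (p q : ℕ) {x : NC k Z p q} (hx : x ∈ NC.D k Z p q) :
    NC.integrate k Z p q x = 0 := by
  refine NC.D_le (LinearMap.ker (NC.integrate k Z p q)) (fun p' f j hj x => ?_) hx
  rw [LinearMap.mem_ker]
  funext w
  refine (slant_apply _ _ _).trans (Finset.sum_eq_zero fun h _ => ?_)
  obtain ⟨t, ht, h1, h2⟩ := exists_climb_step h.μ h.card_μ j
  refine mul_eq_zero_of_right _ (x.2 _ ?_)
  change (TopCat.toSSet.map (Z.map f)).app (Opposite.op ⦋q⦌)
    ((TopCat.toSSet.map (evaluation Z p)).app (Opposite.op ⦋q⦌) _) ∈ _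
  rw [evaluation_simplex]
  refine SSet.degenerate_app_apply ?_ _
  have hl : (h.left ≫ f) t.castSucc = (h.left ≫ f) t.succ := by
    change f (h.left t.castSucc) = f (h.left t.succ)
    rw [Shuffle.left, h1, h2, hj]
  have hr : h.right t.castSucc = h.right t.succ := climb_flat _ _ (by simpa using ht)
  generalize h.left ≫ f = a at hl
  generalize h.right = b at hr
  cases q with
  | zero => exact t.elim0
  | succ q =>
    obtain ⟨a, rfl⟩ := SimplexCategory.eq_σ_comp_of_not_injective' a t hl
    obtain ⟨b, rfl⟩ := SimplexCategory.eq_σ_comp_of_not_injective' b t hr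
    refine ⟨q, by omega, SimplexCategory.σ t, prodSimplex
      ((TopCat.toSSet.obj _).map a.op (fundamentalSimplex p'))
      ((TopCat.toSSet.obj _).map b.op w), ?_⟩
    rw [op_comp, op_comp, Functor.map_comp_apply, Functor.map_comp_apply]
    rfl

variable (k Z)

/-- The comparison map `φ : |NN(Z)|^* → C^*(‖Z‖)`, induced on `N_p N^q(Z)` by the composite
`C^q(Z[p]) → C^q(Δ^p × ‖Z‖) → C^{q-p}(‖Z‖)` of `C^q(e_p)` and the slant product by `ι_p`. -/
noncomputable def comparison :
    (realization k Z).carrier →ₗ[k] (singularCochains k (geometricRealization Z)).carrier :=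
  DirectSum.toModule k (ℕ × ℕ) _ fun i =>
    DirectSum.lof k ℕ (fun n => Cochain k (TopCat.toSSet.obj (geometricRealization Z)) n)
      (i.2 - i.1) ∘ₗ NN.lift (NC.integrate k Z i.1 i.2) fun _ hx => NC.integrate_D _ _ hx

end Slant

end BenderskyGitler

/-! The map `φ` is integration along the fibre `Δ^p`, and its properties are properties of the
Eilenberg–Zilber shuffle map. A point of `‖Z‖` is a map of cosimplicial spaces, so a cosimplicial
operator on `Z` can be moved onto the fundamental simplex (`evalAt_act`). Integrating `∂x` therefore
amounts to integrating `x` over the boundary of `Δ^p`, and since EZ is a chain map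
(`sum_shuffle_faces` and its two edge cases), Stokes' formula `∫δx = ∫∂x + (-1)^p δ∫x` follows
(`coboundary_integrateAt`). With `d = (-1)^p (δ - ∂)` this says that `φ` commutes with the
differentials.

For products, the value of `φ(x · y)` on a simplex `w` is a sum over pairs `(h, g)`, with `h` from
the shuffle product and `g` from the slant product; the front face of the resulting path feeds `x`
and the back face feeds `y`. Because `x` and `y` are normalized, a pair contributes only if no step
of the front face is collapsed for `x` and none of the back face for `y`. This forces `h` to be the
trivial shuffle and `g` to be the concatenation of a shuffle for `x` and one for `y`
(`Shuffle.eq_initial_of_not_flat`, `Shuffle.exists_append`). What remains is `φ(x) ∪ φ(y)` up to the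
sign `(-1)^{qa}` of the concatenation, where `a = r - p`, and this is exactly the Koszul sign in the
product (`integrateAt_shuffle_eq_cup`). Normalization also gives the vanishing on degenerate `w`.

The algebra axioms rest on the same identities: associativity and the Leibniz rule in the source
combine those of the cup product (`cupAt_assoc`, `coboundary_cup`) with associativity of EZ
(`sum_shuffle_assoc`) and its chain map property.

The identities between shuffles are proved for lattice paths in products of lists of vertices. There
a path is split by its first step, so signs and cancellations become inductions
(`shuffleSum_faceSum`, `shuffleSum_assoc`); `sum_shuffle_eq_shuffleSum` carries the results back to
shuffles. -/

namespace BenderskyGitler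

/-! ### Shuffles of lists -/

section Lists

variable {k : Type v} [Field k] {M : Type w} [AddCommGroup M] [Module k M] {α β γ : Type*}

/-- The signed sum of the values of `G` on all the lattice paths in the product of two lists. -/
def shuffleSum (k : Type v) [Field k] {M : Type w} [AddCommGroup M] [Module k M] {α β : Type*}
    (X : List α) (Y : List β) (G : List (α × β) → M) : M :=
  match X, Y with
  | [], _ => 0
  | _ :: _, [] => 0
  | x :: xs, y :: ys => (if xs.length = 0 ∧ ys.length = 0 then G [(x, y)] else 0) +
      shuffleSum k xs (y :: ys) (fun L => G ((x, y) :: L)) +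
      -- A first step in the second direction precedes all the `xs.length` steps in the first
      -- direction, hence adds that many inversions.
      (-1 : k) ^ xs.length • shuffleSum k (x :: xs) ys fun L => G ((x, y) :: L)
termination_by X.length + Y.length
decreasing_by all_goals simp

/-- The alternating sum of the values of `G` on the lists obtained by removing one entry. -/
def faceSum {M : Type w} [AddCommGroup M] {α : Type*} (X : List α) (G : List α → M) : M :=
  match X with
  | [] => 0
  | x :: xs => G xs - faceSum xs fun L => G (x :: L)

@[simp] lemma shuffleSum_nil_left (Y : List β) (G : List (α × β) → M) :
    shuffleSum k [] Y G = 0 := by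
  rw [shuffleSum]

@[simp] lemma shuffleSum_nil_right (X : List α) (G : List (α × β) → M) :
    shuffleSum k X [] G = 0 := by
  cases X <;> rw [shuffleSum]

lemma shuffleSum_cons (x : α) (xs : List α) (y : β) (ys : List β) (G : List (α × β) → M) :
    shuffleSum k (x :: xs) (y :: ys) G =
      (if xs.length = 0 ∧ ys.length = 0 then G [(x, y)] else 0) +
      shuffleSum k xs (y :: ys) (fun L => G ((x, y) :: L)) +
      (-1 : k) ^ xs.length • shuffleSum k (x :: xs) ys fun L => G ((x, y) :: L) := by
  rw [shuffleSum]

@[simp] lemma faceSum_nil (G : List α → M) : faceSum [] G = 0 := rfl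

lemma faceSum_cons (x : α) (xs : List α) (G : List α → M) :
    faceSum (x :: xs) G = G xs - faceSum xs fun L => G (x :: L) := rfl

/-- Induction on a pair of lists along the recursion of `shuffleSum`. -/
lemma list_pair_induction {P : List α → List β → Prop} (h0 : ∀ Y, P [] Y) (h1 : ∀ X, P X [])
    (h : ∀ x xs y ys, P xs (y :: ys) → P (x :: xs) ys → P (x :: xs) (y :: ys))
    (X : List α) (Y : List β) : P X Y := by
  induction X generalizing Y with
  | nil => exact h0 Y
  | cons x xs ihx =>
    induction Y with
    | nil => exact h1 _
    | cons y ys ihy => exact h x xs y ys (ihx _) ihy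

/-- Every path visits exactly `X.length + Y.length - 1` points, so a sign depending on the length of
the path may be treated as a constant. -/
lemma shuffleSum_congr (X : List α) (Y : List β) (G H : List (α × β) → M)
    (h : ∀ L, L ≠ [] → L.length + 1 = X.length + Y.length → G L = H L) :
    shuffleSum k X Y G = shuffleSum k X Y H := by
  induction X, Y using list_pair_induction generalizing G H with
  | h0 Y => simp
  | h1 X => simp
  | h x xs y ys ih1 ih2 =>
    rw [shuffleSum_cons, shuffleSum_cons,
      ih1 _ (fun L => H ((x, y) :: L)) (fun L _ hL => h _ (by simp) (by simp at *; omega)),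
      ih2 _ (fun L => H ((x, y) :: L)) (fun L _ hL => h _ (by simp) (by simp at *; omega))]
    congr 2
    split_ifs with hc
    · exact h _ (by simp) (by simp [hc])
    · rfl

lemma shuffleSum_add (X : List α) (Y : List β) (G H : List (α × β) → M) :
    shuffleSum k X Y (fun L => G L + H L) = shuffleSum k X Y G + shuffleSum k X Y H := by
  induction X, Y using list_pair_induction generalizing G H with
  | h0 Y => simp
  | h1 X => simp
  | h x xs y ys ih1 ih2 =>
    rw [shuffleSum_cons, shuffleSum_cons, shuffleSum_cons, ih1, ih2, smul_add]
    split_ifs <;> abel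

lemma shuffleSum_smul (X : List α) (Y : List β) (c : k) (G : List (α × β) → M) :
    shuffleSum k X Y (fun L => c • G L) = c • shuffleSum k X Y G := by
  induction X, Y using list_pair_induction generalizing G with
  | h0 Y => simp
  | h1 X => simp
  | h x xs y ys ih1 ih2 =>
    rw [shuffleSum_cons, shuffleSum_cons, ih1, ih2, smul_add, smul_add, smul_ite, smul_zero,
      smul_comm c]

lemma shuffleSum_zero (X : List α) (Y : List β) :
    shuffleSum k X Y (fun _ => (0 : M)) = 0 := by
  simpa using! shuffleSum_smul X Y (0 : k) fun _ => (0 : M)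

lemma shuffleSum_sub (X : List α) (Y : List β) (G H : List (α × β) → M) :
    shuffleSum k X Y (fun L => G L - H L) = shuffleSum k X Y G - shuffleSum k X Y H := by
  have h := shuffleSum_add (k := k) X Y G fun L => (-1 : k) • H L
  rw [shuffleSum_smul] at h
  simpa [sub_eq_add_neg] using h

lemma faceSum_congr (X : List α) (G H : List α → M)
    (h : ∀ L, L.length + 1 = X.length → G L = H L) : faceSum X G = faceSum X H := by
  induction X generalizing G H with
  | nil => rfl
  | cons x xs ih =>
    rw [faceSum_cons, faceSum_cons, h xs (by simp),
      ih _ (fun L => H (x :: L)) (fun L hL => h _ (by simpa using hL))]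

lemma faceSum_add (X : List α) (G H : List α → M) :
    faceSum X (fun L => G L + H L) = faceSum X G + faceSum X H := by
  induction X generalizing G H with
  | nil => simp
  | cons x xs ih => rw [faceSum_cons, faceSum_cons, faceSum_cons, ih]; abel

lemma faceSum_sub (X : List α) (G H : List α → M) :
    faceSum X (fun L => G L - H L) = faceSum X G - faceSum X H := by
  induction X generalizing G H with
  | nil => simp
  | cons x xs ih => rw [faceSum_cons, faceSum_cons, faceSum_cons, ih]; abel

/-- Removing the same two entries in either order gives the same list with opposite signs. -/
lemma faceSum_faceSum (X : List α) (G : List α → M) :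
    faceSum X (fun L => faceSum L G) = 0 := by
  induction X generalizing G with
  | nil => rfl
  | cons x xs ih => simp only [faceSum_cons, faceSum_sub, ih, sub_zero, sub_self]

lemma faceSum_smul (X : List α) (c : k) (G : List α → M) :
    faceSum X (fun L => c • G L) = c • faceSum X G := by
  induction X generalizing G with
  | nil => simp
  | cons x xs ih => rw [faceSum_cons, faceSum_cons, ih, smul_sub]

/-- Follows the terminal term of `shuffleSum_cons` through a face sum: the tail becomes empty after
a deletion exactly when it had one entry. -/
lemma faceSum_length_eq_zero (X : List α) (c : Prop) [Decidable c] (m : M) :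
    faceSum X (fun L => if L.length = 0 ∧ c then m else 0) =
      if X.length = 1 ∧ c then m else 0 := by
  have hz : ∀ X : List α, faceSum X (fun _ => (0 : M)) = 0 := fun X => by
    induction X with
    | nil => rfl
    | cons x xs ih => rw [faceSum_cons, ih, sub_zero]
  cases X with
  | nil => simp
  | cons x xs => simp [faceSum_cons, hz]

/-- The boundary of the shuffle product of two lists. -/
theorem shuffleSum_faceSum (X : List α) (Y : List β) (G : List (α × β) → M) :
    shuffleSum k X Y (fun L => faceSum L G) =
      faceSum X (fun X' => shuffleSum k X' Y G) -
        (-1 : k) ^ X.length • faceSum Y (fun Y' => shuffleSum k X Y' G) +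
        if X.length = 1 ∧ Y.length = 1 then G [] else 0 := by
  -- The last term of the formula is an augmentation: for two singletons the only path is a point,
  -- whose single face is the empty list, while the two other terms vanish.
  induction X, Y using list_pair_induction generalizing G with
  | h0 Y =>
    have h := faceSum_smul (k := k) (M := M) Y 0 fun _ => 0
    simp only [smul_zero, zero_smul] at h
    simp [h]
  | h1 X =>
    have h := faceSum_smul (k := k) (M := M) X 0 fun _ => 0
    simp only [smul_zero, zero_smul] at h
    simp [h]
  | h x xs y ys ih1 ih2 =>
    have hX : faceSum xs (fun xs' => shuffleSum k (x :: xs') (y :: ys) G) =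
        (if xs.length = 1 ∧ ys.length = 0 then G [(x, y)] else 0) +
        faceSum xs (fun xs' => shuffleSum k xs' (y :: ys) fun L => G ((x, y) :: L)) -
        (-1 : k) ^ xs.length •
          faceSum xs fun xs' => shuffleSum k (x :: xs') ys fun L => G ((x, y) :: L) := by
      simp only [shuffleSum_cons]
      rw [faceSum_add, faceSum_add, faceSum_length_eq_zero, sub_eq_add_neg, ← neg_smul,
        ← faceSum_smul]
      congr 1
      -- Here `L` is one entry shorter than `xs`, so the sign of the recursion changes.
      refine faceSum_congr _ _ _ fun L hL => ?_
      rw [← hL, pow_succ, mul_neg_one, neg_neg]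
    have hY : faceSum ys (fun ys' => shuffleSum k (x :: xs) (y :: ys') G) =
        (if ys.length = 1 ∧ xs.length = 0 then G [(x, y)] else 0) +
        faceSum ys (fun ys' => shuffleSum k xs (y :: ys') fun L => G ((x, y) :: L)) +
        (-1 : k) ^ xs.length •
          faceSum ys fun ys' => shuffleSum k (x :: xs) ys' fun L => G ((x, y) :: L) := by
      simp only [shuffleSum_cons, and_comm (a := xs.length = 0)]
      rw [faceSum_add, faceSum_add, faceSum_length_eq_zero, ← faceSum_smul]
    have hsq : (-1 : k) ^ xs.length * (-1 : k) ^ xs.length = 1 := by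
      rw [← mul_pow]; simp
    rw [shuffleSum_cons]
    simp only [faceSum_cons]
    -- After these expansions the sum over paths in `xs` and `ys` occurs twice with opposite signs:
    -- the corner of a path can be removed whether the first two steps go right then up or up then
    -- right. The lengths `0` and `1` are then separated because of the terminal terms.
    rw [shuffleSum_sub, shuffleSum_sub, ih1, ih2, hX, hY]
    simp only [faceSum_cons, List.length_cons, pow_succ, smul_sub, smul_add, smul_smul, mul_neg,
      mul_one, hsq, neg_smul, smul_neg, one_smul, faceSum_nil, Nat.succ_inj, smul_ite, smul_zero, neg_mul]
    by_cases h1 : xs.length = 0 <;> by_cases h2 : ys.length = 0 <;>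
      by_cases h3 : xs.length = 1 <;> by_cases h4 : ys.length = 1 <;>
      first
        | omega
        | simp only [h1, h2, h3, h4, and_self, if_true, if_false, and_true, and_false,
            pow_zero, pow_one, zero_ne_one, one_ne_zero]
          abel

/-- An iterated shuffle sum runs over lattice paths in a three-dimensional grid. This is its
recursion by the direction of the first step; `shuffleSum_assoc_right_cons` shows that the other
bracketing obeys the same recursion with the same signs. -/
lemma shuffleSum_assoc_left_cons (x : α) (xs : List α) (y : β) (ys : List β) (z : γ) (zs : List γ)
    (G : List ((α × β) × γ) → M) :
    shuffleSum k (x :: xs) (y :: ys) (fun L => shuffleSum k L (z :: zs) G) =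
      (if xs.length = 0 ∧ ys.length = 0 ∧ zs.length = 0 then G [((x, y), z)] else 0) +
      shuffleSum k xs (y :: ys)
        (fun L => shuffleSum k L (z :: zs) fun N => G (((x, y), z) :: N)) +
      (-1 : k) ^ xs.length • shuffleSum k (x :: xs) ys
        (fun L => shuffleSum k L (z :: zs) fun N => G (((x, y), z) :: N)) +
      (-1 : k) ^ (xs.length + ys.length) • shuffleSum k (x :: xs) (y :: ys)
        (fun L => shuffleSum k L zs fun N => G (((x, y), z) :: N)) := by
  -- Once the first point has been split off, the remaining path `L` has `xs.length + ys.length`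
  -- points, so the sign of a first step along `z` does not depend on `L`.
  have key : ∀ (X : List α) (Y : List β), X.length + Y.length = xs.length + ys.length + 1 →
      shuffleSum k X Y (fun L => shuffleSum k ((x, y) :: L) (z :: zs) G) =
      shuffleSum k X Y (fun L => shuffleSum k L (z :: zs) fun N => G (((x, y), z) :: N)) +
      (-1 : k) ^ (xs.length + ys.length) • shuffleSum k X Y
        (fun L => shuffleSum k ((x, y) :: L) zs fun N => G (((x, y), z) :: N)) := by
    intro X Y h
    rw [← shuffleSum_smul, ← shuffleSum_add]
    refine shuffleSum_congr _ _ _ _ fun L hL hl => ?_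
    rw [shuffleSum_cons, if_neg (by simp [hL]), zero_add,
      show L.length = xs.length + ys.length by omega]
  rw [shuffleSum_cons, key _ _ (by simp; omega), key _ _ (by simp; omega),
    shuffleSum_cons x xs y ys (fun L => shuffleSum k L zs _), shuffleSum_cons (x, y) [] z zs]
  by_cases h1 : xs.length = 0 <;> by_cases h2 : ys.length = 0 <;>
    simp only [h1, h2, and_self, if_true, if_false, true_and, and_true, and_false,
      false_and, pow_zero, zero_add, add_zero, smul_add, smul_comm ((-1 : k) ^ xs.length),
      one_smul, shuffleSum_nil_left, List.length_nil] <;> abel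

lemma shuffleSum_assoc_right_cons (x : α) (xs : List α) (y : β) (ys : List β) (z : γ)
    (zs : List γ) (G : List (α × β × γ) → M) :
    shuffleSum k (y :: ys) (z :: zs) (fun L => shuffleSum k (x :: xs) L G) =
      (if xs.length = 0 ∧ ys.length = 0 ∧ zs.length = 0 then G [(x, y, z)] else 0) +
      shuffleSum k (y :: ys) (z :: zs)
        (fun L => shuffleSum k xs L fun N => G ((x, y, z) :: N)) +
      (-1 : k) ^ xs.length • shuffleSum k ys (z :: zs)
        (fun L => shuffleSum k (x :: xs) L fun N => G ((x, y, z) :: N)) +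
      (-1 : k) ^ (xs.length + ys.length) • shuffleSum k (y :: ys) zs
        (fun L => shuffleSum k (x :: xs) L fun N => G ((x, y, z) :: N)) := by
  have key : ∀ (Y : List β) (Z : List γ),
      shuffleSum k Y Z (fun L => shuffleSum k (x :: xs) ((y, z) :: L) G) =
      shuffleSum k Y Z (fun L => shuffleSum k xs ((y, z) :: L) fun N => G ((x, y, z) :: N)) +
      (-1 : k) ^ xs.length • shuffleSum k Y Z
        (fun L => shuffleSum k (x :: xs) L fun N => G ((x, y, z) :: N)) := by
    intro Y Z
    rw [← shuffleSum_smul, ← shuffleSum_add]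
    refine shuffleSum_congr _ _ _ _ fun L hL hl => ?_
    rw [shuffleSum_cons, if_neg (by simp [hL]), zero_add]
  rw [shuffleSum_cons, key, key, shuffleSum_cons y ys z zs (fun L => shuffleSum k xs L _),
    shuffleSum_cons x xs (y, z) [], add_comm xs.length, pow_add, mul_smul]
  by_cases h1 : xs.length = 0 <;> by_cases h2 : ys.length = 0 <;> by_cases h3 : zs.length = 0 <;>
    simp only [h1, h2, h3, and_self, if_true, if_false, and_true, and_false,
      pow_zero, zero_add, add_zero, smul_add, smul_zero,
      one_smul, shuffleSum_nil_right, List.length_nil] <;> abel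

theorem shuffleSum_assoc (X : List α) (Y : List β) (Z : List γ) (G : List (α × β × γ) → M) :
    shuffleSum k X Y (fun L => shuffleSum k L Z fun N =>
      G (N.map fun a => (a.1.1, a.1.2, a.2))) =
    shuffleSum k Y Z fun L => shuffleSum k X L G := by
  induction X generalizing Y Z G with
  | nil => simp [shuffleSum_zero]
  | cons x xs ihx =>
    induction Y generalizing Z G with
    | nil => simp
    | cons y ys ihy =>
      induction Z generalizing G with
      | nil => simp [shuffleSum_zero]
      | cons z zs ihz =>
        rw [shuffleSum_assoc_left_cons, shuffleSum_assoc_right_cons, ← ihx, ← ihy, ← ihz]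
        rfl

end Lists
/-! ### The recursive structure of shuffles -/

lemma climb_zero {n p : ℕ} (μ : Finset (Fin n)) (h : μ.card = p) :
    (climb μ h 0 : Fin (p + 1)) = 0 := by
  apply Fin.ext
  rw [climb_apply_val]
  simp

lemma climb_val_succ_of_succ {n p p' : ℕ} {μ : Finset (Fin n)} (h : μ.card = p)
    {μ' : Finset (Fin (n + 1))} (h' : μ'.card = p') (hμ : ∀ t, t.succ ∈ μ' ↔ t ∈ μ)
    (i : Fin (n + 1)) :
    (climb μ' h' i.succ : Fin (p' + 1)).val =
      (climb μ h i : Fin (p + 1)).val + if 0 ∈ μ' then 1 else 0 := by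
  induction i using Fin.induction with
  | zero =>
    rw [climb_succ, climb_zero, Fin.castSucc_zero, climb_zero]
    rfl
  | succ t ih =>
    rw [climb_succ, ← Fin.succ_castSucc, ih, climb_succ]
    simp only [hμ]
    omega

lemma card_insert_zero_map_succ {n : ℕ} (μ : Finset (Fin n)) :
    (insert 0 (μ.map (Fin.succEmb n))).card = μ.card + 1 := by
  rw [Finset.card_insert_of_notMem (by simp [Fin.succ_ne_zero]), Finset.card_map]

lemma card_eq_sum_ite {n : ℕ} (μ : Finset (Fin n)) : μ.card = ∑ m, if m ∈ μ then 1 else 0 := by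
  simp

namespace Shuffle

variable {p q n : ℕ}

/-- The shuffle starting with a step in the first direction. -/
def consLeft (h : Shuffle p q n) : Shuffle (p + 1) q (n + 1) where
  μ := insert 0 (h.μ.map (Fin.succEmb n))
  card_μ := by rw [card_insert_zero_map_succ, h.card_μ]
  card_ν := by
    refine Eq.trans ?_ h.card_ν
    rw [card_eq_sum_ite, card_eq_sum_ite, Fin.sum_univ_succ]
    simp [Fin.succ_ne_zero]

/-- The shuffle starting with a step in the second direction. -/
def consRight (h : Shuffle p q n) : Shuffle p (q + 1) (n + 1) where
  μ := h.μ.map (Fin.succEmb n)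
  card_μ := by rw [Finset.card_map, h.card_μ]
  card_ν := by
    refine Eq.trans ?_ (congrArg (· + 1) h.card_ν)
    rw [card_eq_sum_ite, card_eq_sum_ite h.μᶜ, Fin.sum_univ_succ]
    simp [Fin.succ_ne_zero, add_comm]

lemma zero_mem_consLeft (h : Shuffle p q n) : 0 ∈ h.consLeft.μ := by
  simp [consLeft]

lemma zero_notMem_consRight (h : Shuffle p q n) : 0 ∉ h.consRight.μ := by
  simp [consRight, Fin.succ_ne_zero]

lemma succ_mem_consLeft (h : Shuffle p q n) (t : Fin n) : t.succ ∈ h.consLeft.μ ↔ t ∈ h.μ := by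
  simp [consLeft, Fin.succ_ne_zero]

lemma succ_mem_consRight (h : Shuffle p q n) (t : Fin n) :
    t.succ ∈ h.consRight.μ ↔ t ∈ h.μ := by
  simp [consRight]

lemma left_zero (h : Shuffle p q n) : h.left (0 : Fin (n + 1)) = (0 : Fin (p + 1)) :=
  climb_zero _ _

lemma right_zero (h : Shuffle p q n) : h.right (0 : Fin (n + 1)) = (0 : Fin (q + 1)) :=
  climb_zero _ _

lemma consLeft_left_succ (h : Shuffle p q n) (i : Fin (n + 1)) :
    h.consLeft.left i.succ = Fin.succ (h.left i : Fin (p + 1)) :=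
  Fin.ext <| (climb_val_succ_of_succ h.card_μ _ h.succ_mem_consLeft i).trans <| by
    rw [if_pos h.zero_mem_consLeft]; rfl

lemma consLeft_right_succ (h : Shuffle p q n) (i : Fin (n + 1)) :
    h.consLeft.right i.succ = (h.right i : Fin (q + 1)) :=
  Fin.ext <| (climb_val_succ_of_succ h.card_ν _
    (fun t => by simp [h.succ_mem_consLeft]) i).trans <| by
      rw [if_neg (by simp [h.zero_mem_consLeft])]; rfl

lemma consRight_left_succ (h : Shuffle p q n) (i : Fin (n + 1)) :
    h.consRight.left i.succ = (h.left i : Fin (p + 1)) :=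
  Fin.ext <| (climb_val_succ_of_succ h.card_μ _ h.succ_mem_consRight i).trans <| by
    rw [if_neg h.zero_notMem_consRight]; rfl

lemma consRight_right_succ (h : Shuffle p q n) (i : Fin (n + 1)) :
    h.consRight.right i.succ = Fin.succ (h.right i : Fin (q + 1)) :=
  Fin.ext <| (climb_val_succ_of_succ h.card_ν _
    (fun t => by simp [h.succ_mem_consRight]) i).trans <| by
      rw [if_pos (by simp [h.zero_notMem_consRight])]; rfl

lemma inversions_eq_sum (h : Shuffle p q n) :
    h.inversions = ∑ m, ∑ l, if m ∈ h.μ ∧ l ∉ h.μ ∧ l < m then 1 else 0 := by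
  rw [← Fintype.sum_prod_type' (f := fun m l : Fin n => if m ∈ h.μ ∧ l ∉ h.μ ∧ l < m then 1 else 0),
    ← Finset.card_filter, inversions]
  congr 1
  ext ml
  simp [and_assoc]

lemma inversions_consLeft (h : Shuffle p q n) : h.consLeft.inversions = h.inversions := by
  simp only [inversions_eq_sum, Fin.sum_univ_succ, succ_mem_consLeft, zero_mem_consLeft,
    Fin.succ_lt_succ_iff]
  simp

/-- The new first step belongs to `ν` and precedes the `p` elements of `μ`, which accounts for the
sign in `shuffleSum_cons`. -/
lemma inversions_consRight (h : Shuffle p q n) :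
    h.consRight.inversions = p + h.inversions := by
  simp only [inversions_eq_sum, Fin.sum_univ_succ, succ_mem_consRight, zero_notMem_consRight,
    Fin.succ_lt_succ_iff, Finset.sum_add_distrib]
  simp [h.card_μ]

lemma consLeft_injective : Function.Injective (consLeft : Shuffle p q n → _) := fun a b h =>
  μ_injective <| Finset.ext fun t => by rw [← succ_mem_consLeft, h, succ_mem_consLeft]

lemma consRight_injective : Function.Injective (consRight : Shuffle p q n → _) := fun a b h =>
  μ_injective <| Finset.ext fun t => by rw [← succ_mem_consRight, h, succ_mem_consRight]

lemma exists_consLeft (s : Shuffle (p + 1) q (n + 1)) (hs : 0 ∈ s.μ) :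
    ∃ h : Shuffle p q n, h.consLeft = s := by
  have h1 := s.card_μ
  have h2 := s.card_ν
  rw [card_eq_sum_ite, Fin.sum_univ_succ] at h1 h2
  refine ⟨⟨Finset.univ.filter fun t => t.succ ∈ s.μ, ?_, ?_⟩, μ_injective <| Finset.ext fun t => ?_⟩
  · rw [card_eq_sum_ite]
    simp [hs] at h1 ⊢
    omega
  · rw [card_eq_sum_ite]
    simp [hs] at h2 ⊢
    omega
  · cases t using Fin.cases with
    | zero => simp [zero_mem_consLeft, hs]
    | succ t => simp [succ_mem_consLeft]

lemma exists_consRight (s : Shuffle p (q + 1) (n + 1)) (hs : 0 ∉ s.μ) :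
    ∃ h : Shuffle p q n, h.consRight = s := by
  have h1 := s.card_μ
  have h2 := s.card_ν
  rw [card_eq_sum_ite, Fin.sum_univ_succ] at h1 h2
  refine ⟨⟨Finset.univ.filter fun t => t.succ ∈ s.μ, ?_, ?_⟩, μ_injective <| Finset.ext fun t => ?_⟩
  · rw [card_eq_sum_ite]
    simp [hs] at h1 ⊢
    omega
  · rw [card_eq_sum_ite]
    simp [hs] at h2 ⊢
    omega
  · cases t using Fin.cases with
    | zero => simp [zero_notMem_consRight, hs]
    | succ t => simp [succ_mem_consRight]

variable {M : Type w} [AddCommMonoid M]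

/-- Shuffles are sorted by their first step, that is by whether `0` lies in `μ`. -/
lemma sum_succ_succ (f : Shuffle (p + 1) (q + 1) (n + 1) → M) :
    ∑ h, f h = ∑ h : Shuffle p (q + 1) n, f h.consLeft + ∑ h : Shuffle (p + 1) q n, f h.consRight := by
  have hb : Function.Bijective (Sum.elim consLeft consRight :
      Shuffle p (q + 1) n ⊕ Shuffle (p + 1) q n → Shuffle (p + 1) (q + 1) (n + 1)) := by
    refine ⟨consLeft_injective.sumElim consRight_injective fun a b hab => ?_, fun s => ?_⟩
    · exact zero_notMem_consRight b (hab ▸ zero_mem_consLeft a)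
    · by_cases hs : 0 ∈ s.μ
      · obtain ⟨h, rfl⟩ := exists_consLeft s hs
        exact ⟨Sum.inl h, rfl⟩
      · obtain ⟨h, rfl⟩ := exists_consRight s hs
        exact ⟨Sum.inr h, rfl⟩
  rw [← hb.sum_comp, Fintype.sum_sum_type]
  rfl

lemma sum_succ_zero (f : Shuffle (p + 1) 0 (n + 1) → M) :
    ∑ h, f h = ∑ h : Shuffle p 0 n, f h.consLeft := by
  refine (Function.Bijective.sum_comp (e := consLeft) ⟨consLeft_injective, fun s => ?_⟩ f).symm
  apply exists_consLeft
  have := s.card_ν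
  simp at this
  simp [this]

lemma sum_zero_succ (f : Shuffle 0 (q + 1) (n + 1) → M) :
    ∑ h, f h = ∑ h : Shuffle 0 q n, f h.consRight := by
  refine (Function.Bijective.sum_comp (e := consRight) ⟨consRight_injective, fun s => ?_⟩ f).symm
  apply exists_consRight
  have := s.card_μ
  simp at this
  simp [this]

instance (q : ℕ) : Unique (Shuffle 0 q q) where
  default := ⟨∅, rfl, by simp⟩
  uniq s := μ_injective ((Finset.card_eq_zero.1 s.card_μ).trans rfl)

end Shuffle

section

variable {k : Type v} [Field k] {M : Type w} [AddCommGroup M] [Module k M] {α β γ : Type*}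

/-- The bridge between shuffles and lattice paths: `(h.left, h.right)` runs through the points of
the path, and removing the first step on both sides gives the same recursion with the same signs. -/
theorem sum_shuffle_eq_shuffleSum {p q n : ℕ} (hn : n = p + q) (X : Fin (p + 1) → α)
    (Y : Fin (q + 1) → β) (G : List (α × β) → M) :
    ∑ h : Shuffle p q n, (-1 : k) ^ h.inversions •
      G (List.ofFn fun i : Fin (n + 1) => (X (h.left i), Y (h.right i))) =
    shuffleSum k (List.ofFn X) (List.ofFn Y) G := by
  induction n generalizing p q G with
  | zero =>
    obtain rfl : p = 0 := by omega
    obtain rfl : q = 0 := by omega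
    simp [shuffleSum_cons, Shuffle.left_zero, Shuffle.right_zero, Shuffle.inversions_eq_sum]
  | succ n ih =>
    have hl (h : Shuffle p q (n + 1)) :
        (List.ofFn fun i : Fin (n + 1 + 1) => (X (h.left i), Y (h.right i))) =
          (X 0, Y 0) :: List.ofFn fun i : Fin (n + 1) => (X (h.left i.succ), Y (h.right i.succ)) := by
      rw [List.ofFn_succ, h.left_zero, h.right_zero]
    simp only [hl]
    cases p with
    | zero =>
      cases q with
      | zero => omega
      | succ q =>
        rw [Shuffle.sum_zero_succ]
        simp only [Shuffle.consRight_left_succ, Shuffle.consRight_right_succ,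
          Shuffle.inversions_consRight]
        rw [List.ofFn_succ (f := X), List.ofFn_succ (f := Y), shuffleSum_cons,
          if_neg (by simp), ← List.ofFn_succ (f := X),
          ← ih (by omega) X (fun i => Y i.succ) fun L => G ((X 0, Y 0) :: L)]
        simp
    | succ p =>
      cases q with
      | zero =>
        rw [Shuffle.sum_succ_zero]
        simp only [Shuffle.consLeft_left_succ, Shuffle.consLeft_right_succ,
          Shuffle.inversions_consLeft]
        rw [List.ofFn_succ (f := X), List.ofFn_succ (f := Y), shuffleSum_cons,
          if_neg (by simp), ← List.ofFn_succ (f := Y),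
          ← ih (by omega) (fun i => X i.succ) Y fun L => G ((X 0, Y 0) :: L)]
        simp
      | succ q =>
        rw [Shuffle.sum_succ_succ]
        simp only [Shuffle.consRight_left_succ, Shuffle.consRight_right_succ,
          Shuffle.inversions_consRight, Shuffle.consLeft_left_succ, Shuffle.consLeft_right_succ,
          Shuffle.inversions_consLeft]
        rw [List.ofFn_succ (f := X), List.ofFn_succ (f := Y), shuffleSum_cons,
          if_neg (by simp), ← List.ofFn_succ (f := X), ← List.ofFn_succ (f := Y),
          ← ih (by omega) (fun i => X i.succ) Y fun L => G ((X 0, Y 0) :: L),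
          ← ih (by omega) X (fun i => Y i.succ) fun L => G ((X 0, Y 0) :: L)]
        simp [pow_add, mul_smul, Finset.smul_sum]

theorem faceSum_ofFn {n : ℕ} (X : Fin (n + 1) → α) (G : List α → M) :
    faceSum (List.ofFn X) G =
      ∑ i : Fin (n + 1), (-1 : k) ^ (i : ℕ) • G (List.ofFn fun j => X (i.succAbove j)) := by
  induction n generalizing G with
  | zero => simp [faceSum_cons]
  | succ n ih =>
    rw [List.ofFn_succ, faceSum_cons, ih, sub_eq_add_neg, ← Finset.sum_neg_distrib,
      Fin.sum_univ_succ (n := n + 1)]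
    congr 1
    · simp
    · refine Finset.sum_congr rfl fun i _ => ?_
      rw [← neg_smul, Fin.val_succ, pow_succ, mul_neg_one, List.ofFn_succ, Fin.succ_succAbove_zero]
      simp only [Fin.succ_succAbove_succ]

end

/-! ### Identities between sums over shuffles -/

section

variable {k : Type v} [Field k] {M : Type w} [AddCommGroup M] [Module k M] {p q r n : ℕ}

/-- The list of vertices of a simplex of `Δ^p × Δ^q`. -/
def vertexList (a : (⦋n⦌ ⟶ ⦋p⦌) × (⦋n⦌ ⟶ ⦋q⦌)) : List (Fin (p + 1) × Fin (q + 1)) :=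
  List.ofFn fun i : Fin (n + 1) => (a.1 i, a.2 i)

lemma vertexList_injective :
    Function.Injective (vertexList : (⦋n⦌ ⟶ ⦋p⦌) × (⦋n⦌ ⟶ ⦋q⦌) → _) := by
  intro a b hab
  have h := List.ofFn_injective hab
  ext i : 4
  · exact congrArg (fun f => (f i).1) h
  · exact congrArg (fun f => (f i).2) h

/-- A function on the `n`-simplices of `Δ^p × Δ^q`, extended by `0` to all lists of vertices. -/
noncomputable def extendToLists (F : (⦋n⦌ ⟶ ⦋p⦌) → (⦋n⦌ ⟶ ⦋q⦌) → M) :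
    List (Fin (p + 1) × Fin (q + 1)) → M :=
  Function.extend vertexList (fun a => F a.1 a.2) 0

/-- A simplex is determined by its vertices, so the extension is consistent. This makes the
identities on lists applicable to functions that are defined only on monotone maps of fixed
dimension. -/
lemma extendToLists_ofFn (F : (⦋n⦌ ⟶ ⦋p⦌) → (⦋n⦌ ⟶ ⦋q⦌) → M) (f : ⦋n⦌ ⟶ ⦋p⦌) (g : ⦋n⦌ ⟶ ⦋q⦌) :
    extendToLists F (List.ofFn fun i : Fin (n + 1) => (f i, g i)) = F f g :=
  vertexList_injective.extend_apply (fun a : (⦋n⦌ ⟶ ⦋p⦌) × (⦋n⦌ ⟶ ⦋q⦌) => F a.1 a.2) 0 (f, g)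

lemma sum_shuffle_faces_aux (hn : n + 1 = p + q) (F : (⦋n⦌ ⟶ ⦋p⦌) → (⦋n⦌ ⟶ ⦋q⦌) → M) :
    ∑ h : Shuffle p q (n + 1), (-1 : k) ^ h.inversions •
      ∑ i : Fin (n + 2), (-1 : k) ^ (i : ℕ) •
        F (SimplexCategory.δ i ≫ h.left) (SimplexCategory.δ i ≫ h.right) =
    faceSum (List.ofFn (id : Fin (p + 1) → _)) (fun X => shuffleSum k X
      (List.ofFn (id : Fin (q + 1) → _)) (extendToLists F)) +
    (-1 : k) ^ p • faceSum (List.ofFn (id : Fin (q + 1) → _)) (fun Y => shuffleSum k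
      (List.ofFn (id : Fin (p + 1) → _)) Y (extendToLists F)) := by
  have h1 := shuffleSum_faceSum (k := k) (List.ofFn (id : Fin (p + 1) → _))
    (List.ofFn (id : Fin (q + 1) → _)) (extendToLists F)
  -- The augmentation term is absent because `p + q` is positive; the list of vertices of `Δ^p` has
  -- length `p + 1`, which turns the minus sign into `+ (-1)^p`.
  rw [if_neg (by simp; omega), add_zero, List.length_ofFn, pow_succ, mul_neg_one, neg_smul,
    sub_neg_eq_add] at h1
  rw [← h1, ← sum_shuffle_eq_shuffleSum hn]
  refine Finset.sum_congr rfl fun h _ => ?_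
  rw [faceSum_ofFn (k := k)]
  congr 1
  refine Finset.sum_congr rfl fun i _ => ?_
  rw [← extendToLists_ofFn F]
  rfl

/-- The list of `id` is the list of vertices of `Δ^{p+1}`, and omitting its `i`-th entry leaves the
vertices of the `i`-th face. -/
lemma faceSum_left_succ (hn : n = p + q) (F : (⦋n⦌ ⟶ ⦋p + 1⦌) → (⦋n⦌ ⟶ ⦋q⦌) → M) :
    faceSum (List.ofFn (id : Fin (p + 1 + 1) → _)) (fun X => shuffleSum k X
      (List.ofFn (id : Fin (q + 1) → _)) (extendToLists F)) =
    ∑ i : Fin (p + 2), (-1 : k) ^ (i : ℕ) • ∑ h : Shuffle p q n, (-1 : k) ^ h.inversions •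
      F (h.left ≫ SimplexCategory.δ i) h.right := by
  rw [faceSum_ofFn (k := k)]
  refine Finset.sum_congr rfl fun i _ => ?_
  rw [← sum_shuffle_eq_shuffleSum hn]
  congr 1
  refine Finset.sum_congr rfl fun h _ => ?_
  rw [← extendToLists_ofFn F]
  rfl

lemma faceSum_right_succ (hn : n = p + q) (F : (⦋n⦌ ⟶ ⦋p⦌) → (⦋n⦌ ⟶ ⦋q + 1⦌) → M) :
    faceSum (List.ofFn (id : Fin (q + 1 + 1) → _)) (fun Y => shuffleSum k
      (List.ofFn (id : Fin (p + 1) → _)) Y (extendToLists F)) =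
    ∑ i : Fin (q + 2), (-1 : k) ^ (i : ℕ) • ∑ h : Shuffle p q n, (-1 : k) ^ h.inversions •
      F h.left (h.right ≫ SimplexCategory.δ i) := by
  rw [faceSum_ofFn (k := k)]
  refine Finset.sum_congr rfl fun i _ => ?_
  rw [← sum_shuffle_eq_shuffleSum hn]
  congr 1
  refine Finset.sum_congr rfl fun h _ => ?_
  rw [← extendToLists_ofFn F]
  rfl

theorem sum_faces_faces (F : (⦋n⦌ ⟶ ⦋n + 2⦌) → M) :
    ∑ i : Fin (n + 3), (-1 : k) ^ (i : ℕ) • ∑ j : Fin (n + 2), (-1 : k) ^ (j : ℕ) •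
      F (SimplexCategory.δ j ≫ SimplexCategory.δ i) = 0 := by
  let v (f : ⦋n⦌ ⟶ ⦋n + 2⦌) : List (Fin (n + 3)) := List.ofFn fun i : Fin (n + 1) => f i
  have hv : Function.Injective v := fun f g hfg => by
    ext i : 3
    exact congrFun (List.ofFn_injective hfg) i
  have h := faceSum_faceSum (List.ofFn (id : Fin (n + 3) → _)) (Function.extend v F 0)
  rw [faceSum_ofFn (k := k)] at h
  refine Eq.trans (Finset.sum_congr rfl fun i _ => congrArg _ ?_) h
  rw [faceSum_ofFn (k := k)]
  refine Finset.sum_congr rfl fun j _ => congrArg _ ?_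
  rw [← hv.extend_apply F 0]
  rfl

/-- The Eilenberg–Zilber shuffle map is a chain map. -/
theorem sum_shuffle_faces (hn : n = p + q + 1)
    (F : (⦋n⦌ ⟶ ⦋p + 1⦌) → (⦋n⦌ ⟶ ⦋q + 1⦌) → M) :
    ∑ h : Shuffle (p + 1) (q + 1) (n + 1), (-1 : k) ^ h.inversions •
      ∑ i : Fin (n + 2), (-1 : k) ^ (i : ℕ) •
        F (SimplexCategory.δ i ≫ h.left) (SimplexCategory.δ i ≫ h.right) =
    ∑ i : Fin (p + 2), (-1 : k) ^ (i : ℕ) • ∑ h : Shuffle p (q + 1) n,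
      (-1 : k) ^ h.inversions • F (h.left ≫ SimplexCategory.δ i) h.right +
    (-1 : k) ^ (p + 1) • ∑ i : Fin (q + 2), (-1 : k) ^ (i : ℕ) • ∑ h : Shuffle (p + 1) q n,
      (-1 : k) ^ h.inversions • F h.left (h.right ≫ SimplexCategory.δ i) := by
  rw [sum_shuffle_faces_aux (by omega), faceSum_left_succ (by omega),
    faceSum_right_succ (by omega)]

/-- Omitting the only vertex of `Δ^0` leaves the empty list, over which there are no paths, so the
boundary of the second factor contributes nothing. -/
theorem sum_shuffle_faces_right_zero (hn : n = p) (F : (⦋n⦌ ⟶ ⦋p + 1⦌) → (⦋n⦌ ⟶ ⦋0⦌) → M) :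
    ∑ h : Shuffle (p + 1) 0 (n + 1), (-1 : k) ^ h.inversions •
      ∑ i : Fin (n + 2), (-1 : k) ^ (i : ℕ) •
        F (SimplexCategory.δ i ≫ h.left) (SimplexCategory.δ i ≫ h.right) =
    ∑ i : Fin (p + 2), (-1 : k) ^ (i : ℕ) • ∑ h : Shuffle p 0 n,
      (-1 : k) ^ h.inversions • F (h.left ≫ SimplexCategory.δ i) h.right := by
  rw [sum_shuffle_faces_aux (by omega), faceSum_left_succ (by omega)]
  simp [faceSum_cons]

theorem sum_shuffle_faces_left_zero (hn : n = q) (F : (⦋n⦌ ⟶ ⦋0⦌) → (⦋n⦌ ⟶ ⦋q + 1⦌) → M) :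
    ∑ h : Shuffle 0 (q + 1) (n + 1), (-1 : k) ^ h.inversions •
      ∑ i : Fin (n + 2), (-1 : k) ^ (i : ℕ) •
        F (SimplexCategory.δ i ≫ h.left) (SimplexCategory.δ i ≫ h.right) =
    ∑ i : Fin (q + 2), (-1 : k) ^ (i : ℕ) • ∑ h : Shuffle 0 q n,
      (-1 : k) ^ h.inversions • F h.left (h.right ≫ SimplexCategory.δ i) := by
  rw [sum_shuffle_faces_aux (by omega), faceSum_right_succ (by omega)]
  simp [faceSum_cons]

/-- The Eilenberg–Zilber shuffle map is associative. -/
theorem sum_shuffle_assoc (hn : n = p + q + r)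
    (F : (⦋n⦌ ⟶ ⦋p⦌) → (⦋n⦌ ⟶ ⦋q⦌) → (⦋n⦌ ⟶ ⦋r⦌) → M) :
    ∑ h : Shuffle p q (p + q), (-1 : k) ^ h.inversions • ∑ g : Shuffle (p + q) r n,
      (-1 : k) ^ g.inversions • F (g.left ≫ h.left) (g.left ≫ h.right) g.right =
    ∑ h : Shuffle q r (q + r), (-1 : k) ^ h.inversions • ∑ g : Shuffle p (q + r) n,
      (-1 : k) ^ g.inversions • F g.left (g.right ≫ h.left) (g.right ≫ h.right) := by
  let v (a : (⦋n⦌ ⟶ ⦋p⦌) × (⦋n⦌ ⟶ ⦋q⦌) × (⦋n⦌ ⟶ ⦋r⦌)) :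
      List (Fin (p + 1) × Fin (q + 1) × Fin (r + 1)) :=
    List.ofFn fun i : Fin (n + 1) => (a.1 i, a.2.1 i, a.2.2 i)
  have hv : Function.Injective v := by
    intro a b hab
    have h := List.ofFn_injective hab
    ext i : 4
    · exact congrArg (fun f => (f i).1) h
    · ext i : 3
      exact congrArg (fun f => (f i).2.1.val) h
    · ext i : 3
      exact congrArg (fun f => (f i).2.2.val) h
  let G := Function.extend v (fun a => F a.1 a.2.1 a.2.2) 0
  have hG (a b c) : F a b c = G (v (a, b, c)) :=
    (hv.extend_apply (fun a => F a.1 a.2.1 a.2.2) 0 (a, b, c)).symm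
  have h1 := shuffleSum_assoc (k := k) (List.ofFn (id : Fin (p + 1) → _))
    (List.ofFn (id : Fin (q + 1) → _)) (List.ofFn (id : Fin (r + 1) → _)) G
  rw [← sum_shuffle_eq_shuffleSum rfl, ← sum_shuffle_eq_shuffleSum rfl] at h1
  convert h1 using 4 with h _ h _
  · rw [← sum_shuffle_eq_shuffleSum hn]
    refine Finset.sum_congr rfl fun g _ => ?_
    rw [hG, List.map_ofFn]
    rfl
  · rw [← sum_shuffle_eq_shuffleSum (show n = p + (q + r) by omega)]
    refine Finset.sum_congr rfl fun g _ => ?_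
    rw [hG]
    rfl

end

/-! ### Concatenation of shuffles -/

lemma climb_apply_val_eq_sum {n p : ℕ} (μ : Finset (Fin n)) (h : μ.card = p) (i : Fin (n + 1)) :
    (climb μ h i : Fin (p + 1)).val = ∑ t, if t ∈ μ ∧ t.val < i.val then 1 else 0 := by
  rw [climb_apply_val, ← Finset.card_filter]
  congr 1
  ext t
  simp [Fin.lt_def]

lemma front_val (p q : ℕ) (i : Fin (p + 1)) : (front p q i : Fin (p + q + 1)).val = i.val := rfl

lemma back_val (p q : ℕ) (i : Fin (q + 1)) : (back p q i : Fin (p + q + 1)).val = i.val + p := rfl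

lemma climb_front_val {m n p p' : ℕ} {μ : Finset (Fin (m + n))} (h : μ.card = p)
    {μ' : Finset (Fin m)} (h' : μ'.card = p') (hμ : ∀ t, Fin.castAdd n t ∈ μ ↔ t ∈ μ')
    (i : Fin (m + 1)) :
    (climb μ h (front m n i) : Fin (p + 1)).val = (climb μ' h' i : Fin (p' + 1)).val := by
  rw [climb_apply_val_eq_sum, climb_apply_val_eq_sum, Fin.sum_univ_add, front_val]
  simp only [hμ, Fin.val_castAdd, Fin.val_natAdd]
  rw [add_eq_left]
  exact Finset.sum_eq_zero fun t _ => if_neg fun ht => by omega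

lemma climb_back_val {m n p p₁ p₂ : ℕ} {μ : Finset (Fin (m + n))} (h : μ.card = p)
    {μ₁ : Finset (Fin m)} (h₁ : μ₁.card = p₁) (hμ₁ : ∀ t, Fin.castAdd n t ∈ μ ↔ t ∈ μ₁)
    {μ₂ : Finset (Fin n)} (h₂ : μ₂.card = p₂) (hμ₂ : ∀ t, Fin.natAdd m t ∈ μ ↔ t ∈ μ₂)
    (i : Fin (n + 1)) :
    (climb μ h (back m n i) : Fin (p + 1)).val = p₁ + (climb μ₂ h₂ i : Fin (p₂ + 1)).val := by
  rw [climb_apply_val_eq_sum, climb_apply_val_eq_sum, Fin.sum_univ_add, back_val, ← h₁,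
    card_eq_sum_ite]
  simp only [hμ₁, hμ₂, Fin.val_castAdd, Fin.val_natAdd]
  congr 1
  · refine Finset.sum_congr rfl fun t _ => ?_
    simp [show t.val < i.val + m by omega]
  · refine Finset.sum_congr rfl fun t _ => ?_
    simp [add_comm m]

namespace Shuffle

variable {p q a b m n : ℕ}

/-- The shuffle all of whose steps in the first direction come first. -/
def initial (p q : ℕ) : Shuffle p q (p + q) where
  μ := Finset.univ.filter fun t => t.val < p
  card_μ := by
    rw [card_eq_sum_ite, Fin.sum_univ_add]
    simp
  card_ν := by
    rw [card_eq_sum_ite, Fin.sum_univ_add]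
    simp

lemma mem_initial (t : Fin (p + q)) : t ∈ (initial p q).μ ↔ t.val < p := by
  simp [initial]

lemma inversions_initial : (initial p q).inversions = 0 := by
  rw [inversions_eq_sum]
  refine Finset.sum_eq_zero fun m _ => Finset.sum_eq_zero fun l _ => if_neg ?_
  rw [mem_initial, mem_initial, Fin.lt_def]
  omega

lemma initial_left_val (i : Fin (p + q + 1)) :
    ((initial p q).left i : Fin (p + 1)).val = min i.val p := by
  refine (climb_apply_val_eq_sum _ _ _).trans ?_
  simp only [mem_initial]
  rw [Fin.sum_univ_eq_sum_range (fun t => if t < p ∧ t < i.val then 1 else 0), ← Finset.card_filter]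
  trans (Finset.range (min i.val p)).card
  · congr 1
    ext t
    simp only [Finset.mem_filter, Finset.mem_range]
    omega
  · simp

/-- Each step of the path raises exactly one of the two coordinates. -/
lemma left_val_add_right_val (h : Shuffle p q n) (i : Fin (n + 1)) :
    (h.left i : Fin (p + 1)).val + (h.right i : Fin (q + 1)).val = i.val := by
  induction i using Fin.induction with
  | zero => simp [h.left_zero, h.right_zero]
  | succ t ih =>
    have h1 := climb_succ h.μ h.card_μ t
    have h2 := climb_succ h.μᶜ h.card_ν t
    change (h.left t.castSucc : Fin (p + 1)).val + (h.right t.castSucc : Fin (q + 1)).val = t.val at ih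
    change (h.left t.succ : Fin (p + 1)).val = (h.left t.castSucc : Fin (p + 1)).val + _ at h1
    change (h.right t.succ : Fin (q + 1)).val = (h.right t.castSucc : Fin (q + 1)).val + _ at h2
    simp only [Finset.mem_compl] at h2
    rw [Fin.val_succ]
    by_cases ht : t ∈ h.μ <;> simp only [ht, if_true, if_false, not_true, not_false_eq_true] at h1 h2 <;>
      omega

/-- The concatenation of two shuffles. -/
def append (g₁ : Shuffle p a m) (g₂ : Shuffle q b n) : Shuffle (p + q) (a + b) (m + n) where
  μ := Finset.univ.filter fun t => Fin.addCases (motive := fun _ => Bool)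
    (fun t => decide (t ∈ g₁.μ)) (fun t => decide (t ∈ g₂.μ)) t
  card_μ := by
    rw [card_eq_sum_ite, Fin.sum_univ_add]
    simp [g₁.card_μ, g₂.card_μ]
  card_ν := by
    have h₁ := g₁.card_ν
    have h₂ := g₂.card_ν
    rw [card_eq_sum_ite] at h₁ h₂ ⊢
    rw [Fin.sum_univ_add]
    simp only [Finset.mem_compl, Finset.mem_filter, Finset.mem_univ, true_and, Fin.addCases_left,
      Fin.addCases_right, decide_eq_true_eq] at h₁ h₂ ⊢
    rw [h₁, h₂]

variable (g₁ : Shuffle p a m) (g₂ : Shuffle q b n)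

lemma castAdd_mem_append (t : Fin m) : Fin.castAdd n t ∈ (append g₁ g₂).μ ↔ t ∈ g₁.μ := by
  simp [append]

lemma natAdd_mem_append (t : Fin n) : Fin.natAdd m t ∈ (append g₁ g₂).μ ↔ t ∈ g₂.μ := by
  simp [append]

/-- Each of the `q` steps of `g₂` in the first direction comes after each of the `a` steps of `g₁`
in the second one. The term `q * a` is the source of the Koszul sign in the product. -/
lemma inversions_append :
    (append g₁ g₂).inversions = q * a + g₁.inversions + g₂.inversions := by
  have h₁ := g₁.card_ν
  have h₂ := g₂.card_μ
  rw [card_eq_sum_ite] at h₁ h₂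
  simp only [Finset.mem_compl] at h₁
  have h₃ : ∀ t l : Fin m, Fin.castAdd n t < Fin.castAdd n l ↔ t < l := fun t l => Iff.rfl
  have h₄ : ∀ (t : Fin m) (l : Fin n), Fin.castAdd n t < Fin.natAdd m l := fun t l => by
    simp [Fin.lt_def]; omega
  have h₅ : ∀ (t : Fin m) (l : Fin n), ¬ Fin.natAdd m l < Fin.castAdd n t := fun t l =>
    (h₄ t l).le.not_gt
  simp only [inversions_eq_sum, Fin.sum_univ_add, castAdd_mem_append, natAdd_mem_append, h₃, h₄, h₅,
    Fin.natAdd_lt_natAdd_iff, Finset.sum_add_distrib, and_true, and_false, if_false]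
  have h₆ : ∑ x : Fin n, ∑ y : Fin m, (if x ∈ g₂.μ ∧ y ∉ g₁.μ then 1 else 0) = q * a := by
    refine Eq.trans ?_ (congrArg₂ (· * ·) h₂ h₁)
    rw [Finset.sum_mul_sum]
    refine Finset.sum_congr rfl fun x _ => Finset.sum_congr rfl fun y _ => ?_
    rw [ite_and, mul_ite, mul_one, mul_zero]
    split_ifs <;> rfl
  rw [h₆]
  simp only [Finset.sum_const_zero]
  ring

/-- During its first `m` steps the path stays at levels at most `p`, where the truncation `min · p`
does nothing. -/
lemma front_append_left :
    front m n ≫ (append g₁ g₂).left ≫ (initial p q).left = g₁.left := by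
  ext i : 3
  apply Fin.ext
  refine (initial_left_val _).trans ?_
  refine (congrArg (min · p) (climb_front_val (append g₁ g₂).card_μ g₁.card_μ
    (castAdd_mem_append g₁ g₂) i)).trans ?_
  exact min_eq_left (Nat.le_of_lt_succ (Fin.isLt _))

lemma front_append_right : front m n ≫ (append g₁ g₂).right = g₁.right ≫ front a b := by
  ext i : 3
  exact Fin.ext (climb_front_val (append g₁ g₂).card_ν g₁.card_ν
    (fun t => by simp [castAdd_mem_append]) i)

/-- On the back face the level is `p` plus that of `g₂`, and the second component of `initial`
subtracts `p` there. -/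
lemma back_append_left :
    back m n ≫ (append g₁ g₂).left ≫ (initial p q).right = g₂.left := by
  ext i : 3
  apply Fin.ext
  have h1 := left_val_add_right_val (initial p q) ((append g₁ g₂).left (back m n i))
  have h2 := initial_left_val (p := p) (q := q) ((append g₁ g₂).left (back m n i))
  have h3 := climb_back_val (append g₁ g₂).card_μ g₁.card_μ
    (castAdd_mem_append g₁ g₂) g₂.card_μ (natAdd_mem_append g₁ g₂) i
  change ((append g₁ g₂).left (back m n i) : Fin _).val = p + (g₂.left i : Fin _).val at h3
  change ((initial p q).right ((append g₁ g₂).left (back m n i)) : Fin _).val = (g₂.left i : Fin _).val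
  omega

lemma back_append_right : back m n ≫ (append g₁ g₂).right = g₂.right ≫ back a b := by
  ext i : 3
  apply Fin.ext
  refine (climb_back_val (append g₁ g₂).card_ν g₁.card_ν
    (fun t => by simp [castAdd_mem_append]) g₂.card_ν (fun t => by simp [natAdd_mem_append]) i).trans ?_
  exact add_comm _ _

lemma append_injective : Function.Injective
    fun g : Shuffle p a m × Shuffle q b n => append g.1 g.2 := by
  rintro ⟨g₁, g₂⟩ ⟨g₁', g₂'⟩ h
  dsimp only at h
  refine Prod.ext (μ_injective ?_) (μ_injective ?_)
  · ext t
    rw [← castAdd_mem_append g₁ g₂, h, castAdd_mem_append]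
  · ext t
    rw [← natAdd_mem_append g₁ g₂, h, natAdd_mem_append]

/-- The level reached after `m` steps counts the steps in the first direction taken so far. -/
lemma card_filter_castAdd {p q c m n : ℕ} (g : Shuffle (p + q) c (m + n))
    (hg : (g.left (front m n (Fin.last m)) : Fin _).val = p) :
    (Finset.univ.filter fun t => Fin.castAdd n t ∈ g.μ).card = p := by
  refine Eq.trans ?_ (Eq.trans (climb_front_val g.card_μ
    (μ' := Finset.univ.filter fun t => Fin.castAdd n t ∈ g.μ) rfl (by simp) _).symm hg)
  rw [climb_apply_val_eq_sum, card_eq_sum_ite]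
  exact Finset.sum_congr rfl fun t _ => by simp

lemma card_filter_natAdd {p q c m n : ℕ} (g : Shuffle (p + q) c (m + n))
    (hg : (g.left (front m n (Fin.last m)) : Fin _).val = p) :
    (Finset.univ.filter fun t => Fin.natAdd m t ∈ g.μ).card = q := by
  have h₁ := card_filter_castAdd g hg
  have h := g.card_μ
  rw [card_eq_sum_ite, Fin.sum_univ_add] at h
  rw [card_eq_sum_ite] at h₁ ⊢
  simp only [Finset.mem_filter, Finset.mem_univ, true_and] at h₁ ⊢
  omega

lemma le_of_left_front_last {p q c m n : ℕ} (g : Shuffle (p + q) c (m + n))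
    (hg : (g.left (front m n (Fin.last m)) : Fin _).val = p) : p ≤ m ∧ q ≤ n :=
  ⟨(card_filter_castAdd g hg).symm.trans_le (card_finset_fin_le _),
    (card_filter_natAdd g hg).symm.trans_le (card_finset_fin_le _)⟩

/-- A path at level `p` after `m` steps can be cut there; the cardinalities of the two halves are
then forced. -/
lemma exists_append {p q a b m n : ℕ} (hm : p + a = m) (hn : q + b = n)
    (g : Shuffle (p + q) (a + b) (m + n))
    (hg : (g.left (front m n (Fin.last m)) : Fin _).val = p) :
    ∃ (g₁ : Shuffle p a m) (g₂ : Shuffle q b n), append g₁ g₂ = g := by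
  refine ⟨⟨_, card_filter_castAdd g hg, ?_⟩, ⟨_, card_filter_natAdd g hg, ?_⟩, μ_injective ?_⟩
  · rw [Finset.card_compl, card_filter_castAdd g hg, Fintype.card_fin]
    omega
  · rw [Finset.card_compl, card_filter_natAdd g hg, Fintype.card_fin]
    omega
  · ext t
    cases t using Fin.addCases with
    | left t => exact (castAdd_mem_append _ _ _).trans (by simp)
    | right t => exact (natAdd_mem_append _ _ _).trans (by simp)

lemma mem_μ_of_left_ne (h : Shuffle p q n) {t : Fin n}
    (ht : (h.left t.castSucc : Fin (p + 1)) ≠ h.left t.succ) : t ∈ h.μ := by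
  by_contra hc
  exact ht (climb_flat _ _ hc)

lemma notMem_μ_of_right_ne (h : Shuffle p q n) {t : Fin n}
    (ht : (h.right t.castSucc : Fin (q + 1)) ≠ h.right t.succ) : t ∉ h.μ := fun hc =>
  ht (climb_flat _ _ (by simpa using hc))

/-- The pairs of shuffles which contribute to the evaluation of a shuffle product of normalized
cochains on a shuffle product of simplices. -/
lemma eq_initial_of_not_flat {c : ℕ} (h : Shuffle p q (p + q)) (g : Shuffle (p + q) c (m + n))
    (h₁ : ∀ t : Fin m, ¬ ((front m n ≫ g.left ≫ h.left) t.castSucc =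
        (front m n ≫ g.left ≫ h.left) t.succ ∧
      (front m n ≫ g.right) t.castSucc = (front m n ≫ g.right) t.succ))
    (h₂ : ∀ t : Fin n, ¬ ((back m n ≫ g.left ≫ h.right) t.castSucc =
        (back m n ≫ g.left ≫ h.right) t.succ ∧
      (back m n ≫ g.right) t.castSucc = (back m n ≫ g.right) t.succ)) :
    h = initial p q ∧ (g.left (front m n (Fin.last m)) : Fin _).val = p := by
  set k : Fin (p + q + 1) := g.left (front m n (Fin.last m)) with hk
  have hμ : ∀ j : Fin (p + q), j ∈ h.μ ↔ j.val < k.val := by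
    intro j
    -- Let `t` be the step at which `g` climbs from level `j` to `j + 1`; there the second component
    -- of `g` is constant. If `t` lies in the front face, `h.left` must move at `j`; if it lies in
    -- the back face, `h.right` must move at `j`. Thus `μ` consists of the levels crossed before the
    -- middle vertex.
    obtain ⟨t, ht, e₁, e₂⟩ := exists_climb_step g.μ g.card_μ j
    change (g.left t.castSucc : Fin _) = _ at e₁
    change (g.left t.succ : Fin _) = _ at e₂
    have hr : (g.right t.castSucc : Fin (c + 1)) = g.right t.succ :=
      climb_flat _ _ (by simpa using ht)
    rcases lt_or_ge t.val m with htm | htm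
    · have f₁ : (front m n (Fin.castSucc ⟨t.val, htm⟩) : Fin (m + n + 1)) = t.castSucc := rfl
      have f₂ : (front m n (Fin.succ ⟨t.val, htm⟩) : Fin (m + n + 1)) = t.succ := rfl
      have hj : j ∈ h.μ := h.mem_μ_of_left_ne fun hl => h₁ ⟨t.val, htm⟩ <| by
        change h.left (g.left (front m n _)) = h.left (g.left (front m n _)) ∧
          g.right (front m n _) = g.right (front m n _)
        rw [f₁, f₂, e₁, e₂]
        exact ⟨hl, hr⟩
      have hle : (g.left t.succ : Fin _) ≤ k := g.left.toOrderHom.monotone (by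
        rw [Fin.le_def, front_val]
        simp
        omega)
      rw [e₂, Fin.le_def, Fin.val_succ] at hle
      exact iff_of_true hj (by omega)
    · let t' : Fin n := ⟨t.val - m, by omega⟩
      have f₁ : (back m n t'.castSucc : Fin (m + n + 1)) = t.castSucc :=
        Fin.ext (by change t.val - m + m = t.val; omega)
      have f₂ : (back m n t'.succ : Fin (m + n + 1)) = t.succ :=
        Fin.ext (by change t.val - m + 1 + m = t.val + 1; omega)
      have hj : j ∉ h.μ := h.notMem_μ_of_right_ne fun hl => h₂ t' <| by
        change h.right (g.left (back m n _)) = h.right (g.left (back m n _)) ∧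
          g.right (back m n _) = g.right (back m n _)
        rw [f₁, f₂, e₁, e₂]
        exact ⟨hl, hr⟩
      have hle : k ≤ (g.left t.castSucc : Fin _) := g.left.toOrderHom.monotone (by
        rw [Fin.le_def, front_val]
        simp
        omega)
      rw [e₁, Fin.le_def, Fin.val_castSucc] at hle
      exact iff_of_false hj (by omega)
  -- `h.μ` is the set of all `j < k` and it has `p` elements.
  have hkp : k.val = p := by
    have hcard := h.card_μ
    rw [card_eq_sum_ite] at hcard
    simp only [hμ] at hcard
    rw [Fin.sum_univ_eq_sum_range (fun t => if t < k.val then 1 else 0), ← Finset.card_filter] at hcard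
    refine Eq.trans ?_ hcard
    trans (Finset.range k.val).card
    · simp
    · congr 1
      ext t
      have := k.isLt
      simp only [Finset.mem_filter, Finset.mem_range]
      omega
  refine ⟨μ_injective (Finset.ext fun j => ?_), hkp⟩
  rw [hμ, mem_initial, hkp]

end Shuffle

/-! ### Gradings of direct sums -/

section Graded

variable {k : Type v} [Field k] {ι : Type*} [DecidableEq ι] {M : ι → Type*}
  [∀ i, AddCommGroup (M i)] [∀ i, Module k (M i)] (f : ι → ℤ)

variable (k) in
lemma directSum_lof_induction {P : (⨁ i, M i) → Prop} (x : ⨁ i, M i) (h0 : P 0)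
    (hl : ∀ i y, P (DirectSum.lof k ι M i y)) (ha : ∀ x y, P x → P y → P (x + y)) : P x :=
  DirectSum.induction_on x h0 hl ha

lemma graded_induction {n : ℤ} {P : (⨁ i, M i) → Prop} (h0 : P 0)
    (hl : ∀ i y, f i = n → P (DirectSum.lof k ι M i y)) (ha : ∀ x y, P x → P y → P (x + y))
    {x : ⨁ i, M i} (hx : x ∈ ⨆ (i : ι) (_ : f i = n), LinearMap.range (DirectSum.lof k ι M i)) :
    P x := by
  refine Submodule.iSup_induction _ (motive := P) hx (fun i y hy => ?_) h0 ha
  refine Submodule.iSup_induction _ (motive := P) hy (fun hi z hz => ?_) h0 ha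
  obtain ⟨y, rfl⟩ := hz
  exact hl i y hi

lemma lof_mem_graded {n : ℤ} {i : ι} (hi : f i = n) (y : M i) :
    DirectSum.lof k ι M i y ∈ ⨆ (i : ι) (_ : f i = n), LinearMap.range (DirectSum.lof k ι M i) :=
  Submodule.mem_iSup_of_mem i (Submodule.mem_iSup_of_mem hi ⟨y, rfl⟩)

lemma apply_eq_zero_of_mem_graded {n : ℤ} {x : ⨁ i, M i}
    (hx : x ∈ ⨆ (i : ι) (_ : f i = n), LinearMap.range (DirectSum.lof k ι M i)) (i : ι)
    (hi : f i ≠ n) : x i = 0 := by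
  refine graded_induction (P := fun x : ⨁ i, M i => x i = 0) f rfl (fun j y hj => ?_) (fun x y hx hy => ?_) hx
  · exact DirectSum.of_eq_of_ne _ _ _ (by rintro rfl; exact hi hj)
  · rw [DirectSum.add_apply, hx, hy, add_zero]

/-- The pieces group the summands along the fibres of `f`, so independence can be tested coordinate
by coordinate: each coordinate is zero on all pieces but one. -/
lemma isInternal_graded : DirectSum.IsInternal fun n : ℤ =>
    ⨆ (i : ι) (_ : f i = n), LinearMap.range (DirectSum.lof k ι M i) := by
  rw [DirectSum.isInternal_submodule_iff_iSupIndep_and_iSup_eq_top]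
  constructor
  · intro n
    rw [Submodule.disjoint_def]
    intro x hx hx'
    refine DFinsupp.ext fun i => ?_
    by_cases hi : f i = n
    · refine Submodule.iSup_induction _ (motive := fun x : ⨁ i, M i => x i = 0) hx'
        (fun m y hy => ?_) rfl fun a b ha hb => by rw [DirectSum.add_apply, ha, hb, add_zero]
      refine Submodule.iSup_induction _ (motive := fun x : ⨁ i, M i => x i = 0) hy
        (fun hm z hz => ?_) rfl fun a b ha hb => by rw [DirectSum.add_apply, ha, hb, add_zero]
      exact apply_eq_zero_of_mem_graded f hz i (by rw [hi]; exact hm.symm)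
    · exact apply_eq_zero_of_mem_graded f hx i hi
  · rw [eq_top_iff]
    rintro x -
    exact directSum_lof_induction k x (zero_mem _)
      (fun i y => Submodule.mem_iSup_of_mem (f i) (lof_mem_graded f rfl y))
      fun x y hx hy => add_mem hx hy

end Graded

/-! ### The cup product -/

section Cup

lemma subinterval_val {n : ℕ} (j l : ℕ) (h : j + l ≤ n) (i : Fin (l + 1)) :
    (SimplexCategory.subinterval j l h i : Fin (n + 1)).val = i.val + j := rfl

lemma subinterval_comp {m n : ℕ} (j l j' : ℕ) (h : j + l ≤ m) (h' : j' + m ≤ n) :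
    SimplexCategory.subinterval j l h ≫ SimplexCategory.subinterval j' m h' =
      SimplexCategory.subinterval (j + j') l (by omega) := by
  ext i : 3
  exact Fin.ext (add_assoc _ _ _)

lemma subinterval_self {n : ℕ} (h : 0 + n ≤ n) : SimplexCategory.subinterval 0 n h = 𝟙 ⦋n⦌ := by
  ext i : 3
  rfl

/-- This and the next two lemmas distinguish whether the vertex omitted by a coface lies within the
enlarged interval, above the interval, or at or below its start. -/
lemma subinterval_comp_δ_of_lt {p j n : ℕ} (h : j + (p + 1) ≤ n + 1) (i : Fin (n + 2))
    (i' : Fin (p + 2)) (hi : i.val = i'.val + j) :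
    SimplexCategory.subinterval j p (by omega) ≫ SimplexCategory.δ i =
      SimplexCategory.δ i' ≫ SimplexCategory.subinterval j (p + 1) h := by
  ext t : 3
  change i.succAbove (SimplexCategory.subinterval j p _ t) =
    SimplexCategory.subinterval j (p + 1) h (i'.succAbove t)
  apply Fin.ext
  rw [subinterval_val, Fin.succAbove, Fin.succAbove]
  simp only [Fin.lt_def, Fin.val_castSucc, subinterval_val]
  split_ifs <;> simp [subinterval_val] <;> omega

lemma subinterval_comp_δ_of_gt {p j n : ℕ} (h : j + p ≤ n) (i : Fin (n + 2)) (hi : j + p < i.val) :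
    SimplexCategory.subinterval j p h ≫ SimplexCategory.δ i =
      SimplexCategory.subinterval j p (by omega) := by
  ext t : 3
  change i.succAbove (SimplexCategory.subinterval j p _ t) = _
  apply Fin.ext
  rw [Fin.succAbove_of_castSucc_lt]
  · rfl
  · rw [Fin.lt_def, Fin.val_castSucc, subinterval_val]
    have : t.val < p + 1 := t.isLt
    omega

lemma subinterval_comp_δ_of_le {p j n : ℕ} (h : j + p ≤ n) (i : Fin (n + 2)) (hi : i.val ≤ j) :
    SimplexCategory.subinterval j p h ≫ SimplexCategory.δ i =
      SimplexCategory.subinterval (j + 1) p (by omega) := by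
  ext t : 3
  change i.succAbove (SimplexCategory.subinterval j p _ t) = _
  apply Fin.ext
  rw [Fin.succAbove_of_le_castSucc]
  · rfl
  · rw [Fin.le_def, Fin.val_castSucc, subinterval_val]
    omega

/-- The Alexander–Whitney map is a chain map. -/
theorem sum_front_back_faces {k : Type v} [Field k] {M : Type w} [AddCommGroup M] [Module k M]
    (p q : ℕ) (F : (⦋p⦌ ⟶ ⦋p + q + 1⦌) → (⦋q⦌ ⟶ ⦋p + q + 1⦌) → M) :
    ∑ i : Fin (p + q + 2), (-1 : k) ^ (i : ℕ) •
      F (front p q ≫ SimplexCategory.δ i) (back p q ≫ SimplexCategory.δ i) =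
    ∑ i : Fin (p + 2), (-1 : k) ^ (i : ℕ) •
      F (SimplexCategory.δ i ≫ SimplexCategory.subinterval 0 (p + 1) (by omega))
        (SimplexCategory.subinterval (p + 1) q (by omega)) +
    (-1 : k) ^ p • ∑ i : Fin (q + 2), (-1 : k) ^ (i : ℕ) •
      F (front p (q + 1)) (SimplexCategory.δ i ≫ back p (q + 1)) := by
  -- The right-hand side has two terms more than the left-hand side: the last face of the front part
  -- (`x`) and the zeroth face of the back part (`y`), which cancel.
  have key : ∀ a b a' b' x y : M, a = a' → b = b' → x + y = 0 → a + b = a' + x + (y + b') := by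
    rintro a b _ _ x y rfl rfl h
    rw [add_assoc, ← add_assoc x, h, zero_add]
  -- The faces with `i ≤ p` affect the front factor, those with `i > p` the back factor.
  refine (Fin.sum_congr' _ (show (p + 1) + (q + 1) = p + q + 2 by omega)).symm.trans ?_
  rw [Fin.sum_univ_add, Fin.sum_univ_castSucc (n := p + 1), Fin.sum_univ_succ (n := q + 1), smul_add]
  refine key _ _ _ _ _ _ ?_ ?_ ?_
  · refine Finset.sum_congr rfl fun i _ => ?_
    rw [front, back, subinterval_comp_δ_of_lt (by omega) _ i.castSucc (by simp),
      subinterval_comp_δ_of_le _ _ (by simp; omega)]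
    simp
  · rw [Finset.smul_sum]
    refine Finset.sum_congr rfl fun i _ => ?_
    rw [front, back, subinterval_comp_δ_of_gt _ _ (by simp; omega),
      subinterval_comp_δ_of_lt (by omega) _ i.succ (by simp; omega), smul_smul, ← pow_add]
    congr 2
    simp
    omega
  -- Both extra terms evaluate `F` on the front `p`-face and the back `q`-face of the simplex with
  -- vertex `p + 1`, respectively `p`, omitted on the two factors; their signs are `(-1)^{p+1}` and
  -- `(-1)^p`.
  · have hs : (-1 : k) ^ (Fin.last (p + 1) : ℕ) = -(-1 : k) ^ p := by
      rw [Fin.val_last, pow_succ, mul_neg_one]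
    have hs' : (-1 : k) ^ ((0 : Fin (q + 2)) : ℕ) = 1 := pow_zero _
    rw [hs, hs', ← subinterval_comp_δ_of_lt (p := p) (n := p + q) (j := 0) (by omega)
        (Fin.mk (p + 1) (by omega)) _ (by simp),
      subinterval_comp_δ_of_gt _ _ (by simp), back,
      ← subinterval_comp_δ_of_lt (p := q) (n := p + q) (j := p) (by omega)
        (Fin.mk p (by omega)) _ (by simp), subinterval_comp_δ_of_le (p := q) (j := p) _ _ (by simp),
      neg_smul, one_smul, front, neg_add_cancel]

variable (k : Type v) [Field k] {K : SSet.{u}}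

variable {k} in
/-- The cup product of a `p`-cochain and a `q`-cochain, considered as a cochain of a degree `m`
which is equal to `p + q`. -/
def cupAt {p q m : ℕ} (h : p + q = m) (α : Cochain k K p) (β : Cochain k K q) : Cochain k K m :=
  fun σ => α (K.map (SimplexCategory.subinterval 0 p (by omega)).op σ) *
    β (K.map (SimplexCategory.subinterval p q h.le).op σ)

variable {k}

lemma cupAt_rfl {p q : ℕ} (α : Cochain k K p) (β : Cochain k K q) :
    cupAt rfl α β = cup k K p q α β := rfl

lemma cupAt_mem {p q m : ℕ} (h : p + q = m) {α : Cochain k K p} {β : Cochain k K q}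
    (hα : α ∈ normalized k K p) (hβ : β ∈ normalized k K q) :
    cupAt h α β ∈ normalized k K m := by
  subst h
  exact cup_mem hα hβ

/-- Both sides evaluate the three cochains on consecutive intervals of vertices; keeping the degrees
as free indices avoids transport along associativity of addition. -/
lemma cupAt_assoc {p q r pq qr m : ℕ} (h₁ : p + q = pq) (h₂ : pq + r = m) (h₃ : q + r = qr)
    (h₄ : p + qr = m) (α : Cochain k K p) (β : Cochain k K q) (γ : Cochain k K r) :
    cupAt h₂ (cupAt h₁ α β) γ = cupAt h₄ α (cupAt h₃ β γ) := by
  subst h₁ h₃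
  funext σ
  simp only [cupAt, ← Functor.map_comp_apply, ← op_comp, subinterval_comp, mul_assoc, zero_add,
    add_zero, Nat.add_comm q p]

lemma coboundary_coboundary (n : ℕ) (α : Cochain k K n) :
    coboundary k K (n + 1) (coboundary k K n α) = 0 := by
  funext σ
  have h := sum_faces_faces (k := k) fun f : ⦋n⦌ ⟶ ⦋n + 2⦌ => α (K.map f.op σ)
  simp only [op_comp, Functor.map_comp_apply] at h
  exact h

lemma coboundary_cup {p q : ℕ} (α : Cochain k K p) (β : Cochain k K q) :
    coboundary k K (p + q) (cup k K p q α β) =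
      cupAt (by omega) (coboundary k K p α) β +
        (-1 : k) ^ p • cup k K p (q + 1) α (coboundary k K q β) := by
  funext σ
  have h := sum_front_back_faces (k := k) p q fun f g => α (K.map f.op σ) * β (K.map g.op σ)
  simp only [op_comp, Functor.map_comp_apply, smul_eq_mul] at h
  refine h.trans ?_
  change _ = (∑ i : Fin (p + 2), _) * _ + (-1 : k) ^ p * (_ * ∑ i : Fin (q + 2), _)
  refine congrArg₂ (· + ·) ?_ (congrArg _ ?_)
  · exact (Finset.sum_congr rfl fun i _ => (mul_assoc _ _ _).symm).trans (Finset.sum_mul _ _ _).symm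
  · exact (Finset.sum_congr rfl fun i _ => mul_left_comm _ _ _).trans (Finset.mul_sum _ _ _).symm

end Cup

/-! ### The singular cochain algebra -/

lemma negOnePow_smul (k : Type v) [Field k] {M : Type*} [AddCommGroup M] [Module k M] (n : ℤ)
    (x : M) : n.negOnePow • x = ((n.negOnePow : ℤ) : k) • x := by
  rw [Int.cast_smul_eq_zsmul]
  rfl

lemma negOnePow_natCast_smul {k : Type v} [Field k] {M : Type*} [AddCommGroup M] [Module k M]
    (n : ℕ) (x : M) : (n : ℤ).negOnePow • x = (-1 : k) ^ n • x := by
  rw [negOnePow_smul k, Int.cast_negOnePow_natCast]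

lemma directSum_mul_lof {k : Type v} [Field k] {ι : Type*} [DecidableEq ι] {M : ι → Type*}
    [∀ i, AddCommGroup (M i)] [∀ i, Module k (M i)]
    {N : Type*} [AddCommGroup N] [Module k N] (b : ∀ i j, M i →ₗ[k] M j →ₗ[k] N)
    (i j : ι) (x : M i) (y : M j) :
    DirectSum.toModule k ι ((⨁ i, M i) →ₗ[k] N)
      (fun i => LinearMap.flip <| DirectSum.toModule k ι (M i →ₗ[k] N) fun j =>
        LinearMap.flip (b i j))
      (DirectSum.lof k ι M i x) (DirectSum.lof k ι M j y) = b i j x y := by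
  rw [DirectSum.toModule_lof, LinearMap.flip_apply, DirectSum.toModule_lof, LinearMap.flip_apply]

section Singular

variable (k : Type v) [Field k] (X : TopCat.{u})

/-- The inclusion of the `n`-cochains in the singular cochain algebra. -/
noncomputable def singularCochains.incl (n : ℕ) :
    Cochain k (TopCat.toSSet.obj X) n →ₗ[k] (singularCochains k X).carrier :=
  DirectSum.lof k ℕ (fun n => Cochain k (TopCat.toSSet.obj X) n) n

namespace singularCochains

variable {k X}

lemma d_incl (n : ℕ) (α : Cochain k (TopCat.toSSet.obj X) n) :
    (singularCochains k X).d (incl k X n α) = incl k X (n + 1) (coboundary k _ n α) :=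
  DirectSum.toModule_lof k (φ := fun n =>
    DirectSum.lof k ℕ (fun n => Cochain k (TopCat.toSSet.obj X) n) (n + 1) ∘ₗ coboundary k _ n) n α

lemma mul_incl {p q m : ℕ} (h : p + q = m) (α : Cochain k (TopCat.toSSet.obj X) p)
    (β : Cochain k (TopCat.toSSet.obj X) q) :
    (singularCochains k X).mul (incl k X p α) (incl k X q β) = incl k X m (cupAt h α β) := by
  subst h
  exact directSum_mul_lof (k := k) (M := fun n => Cochain k (TopCat.toSSet.obj X) n)
    (fun p q => (cup k _ p q).compr₂
      (DirectSum.lof k ℕ (fun n => Cochain k (TopCat.toSSet.obj X) n) (p + q))) p q α β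

@[elab_as_elim]
lemma induction {P : (singularCochains k X).carrier → Prop} (x) (h0 : P 0)
    (hl : ∀ n α, P (incl k X n α)) (ha : ∀ x y, P x → P y → P (x + y)) : P x :=
  directSum_lof_induction k (M := fun n => Cochain k (TopCat.toSSet.obj X) n) x h0 hl ha

lemma incl_mem_deg {n : ℤ} {m : ℕ} (h : (m : ℤ) = n) (α : Cochain k (TopCat.toSSet.obj X) m) :
    incl k X m α ∈ (singularCochains k X).deg n :=
  lof_mem_graded (k := k) (M := fun n => Cochain k (TopCat.toSSet.obj X) n) (fun n => (n : ℤ)) h α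

@[elab_as_elim]
lemma deg_induction {n : ℤ} {P : ∀ x, x ∈ (singularCochains k X).deg n → Prop} {x}
    (hx : x ∈ (singularCochains k X).deg n) (h0 : P 0 (zero_mem _))
    (hl : ∀ (m : ℕ) α (h : (m : ℤ) = n), P (incl k X m α) (incl_mem_deg h α))
    (ha : ∀ x y hx hy, P x hx → P y hy → P (x + y) (add_mem hx hy)) : P x hx := by
  have h : ∃ hx, P x hx :=
    graded_induction (P := fun x => ∃ hx, P x hx) (fun n : ℕ => (n : ℤ)) ⟨_, h0⟩
      (fun m α h => ⟨_, hl m α h⟩) (fun x y hx hy => ⟨_, ha x y hx.1 hy.1 hx.2 hy.2⟩) hx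
  exact h.2

lemma one_eq : (singularCochains k X).one = incl k X 0 fun _ => 1 := rfl

theorem isDGAlgebra : (singularCochains k X).IsDGAlgebra where
  isInternal := isInternal_graded (k := k) (M := fun n => Cochain k (TopCat.toSSet.obj X) n)
    (fun n => (n : ℤ))
  one_mem := incl_mem_deg rfl _
  mul_mem m n x y hx hy := by
    induction hx using deg_induction with
    | h0 => simp
    | ha x x' _ _ h h' => rw [map_add, LinearMap.add_apply]; exact add_mem h h'
    | hl p α hp =>
      induction hy using deg_induction with
      | h0 => simp
      | ha y y' _ _ h h' => rw [map_add]; exact add_mem h h'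
      | hl q β hq =>
        rw [mul_incl rfl]
        exact incl_mem_deg (by push_cast; omega) _
  d_mem n x hx := by
    induction hx using deg_induction with
    | h0 => simp
    | ha x x' _ _ h h' => rw [map_add]; exact add_mem h h'
    | hl p α hp =>
      rw [d_incl]
      exact incl_mem_deg (by push_cast; omega) _
  one_mul x := by
    induction x using induction with
    | h0 => simp
    | ha x x' h h' => rw [map_add, h, h']
    | hl p α =>
      rw [one_eq, mul_incl (zero_add p)]
      congr 1
      funext σ
      simp [cupAt, subinterval_self]
  mul_one x := by
    induction x using induction with
    | h0 => simp
    | ha x x' h h' => rw [map_add, LinearMap.add_apply, h, h']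
    | hl p α =>
      rw [one_eq, mul_incl (add_zero p)]
      congr 1
      funext σ
      simp [cupAt, subinterval_self]
  mul_assoc x y z := by
    induction x using induction with
    | h0 => simp
    | ha x x' h h' => simp only [map_add, LinearMap.add_apply, h, h']
    | hl p α =>
      induction y using induction with
      | h0 => simp
      | ha x x' h h' => simp only [map_add, LinearMap.add_apply, h, h']
      | hl q β =>
        induction z using induction with
        | h0 => simp
        | ha x x' h h' => simp only [map_add, h, h']
        | hl r γ =>
          rw [mul_incl rfl, mul_incl rfl, mul_incl rfl, mul_incl (add_assoc p q r).symm, cupAt_assoc]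
  d_d x := by
    induction x using induction with
    | h0 => simp
    | ha x x' h h' => simp only [map_add, h, h', add_zero]
    | hl p α => rw [d_incl, d_incl, coboundary_coboundary, map_zero]
  leibniz n x y hx := by
    induction hx using deg_induction with
    | h0 => simp
    | ha x x' _ _ h h' =>
      simp only [map_add, LinearMap.add_apply, h, h', smul_add]
      abel
    | hl p α hp =>
      induction y using induction with
      | h0 => simp
      | ha x x' h h' =>
        simp only [map_add, h, h', smul_add]
        abel
      | hl q β =>
        subst hp
        rw [mul_incl rfl, d_incl, d_incl, d_incl, mul_incl (show p + 1 + q = p + q + 1 by omega),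
          mul_incl rfl, cupAt_rfl, coboundary_cup, map_add, map_smul, ← negOnePow_natCast_smul,
          cupAt_rfl]
        rfl

end singularCochains

end Singular

/-! ### The cochain algebra of a cosimplicial space -/

namespace Shuffle

instance (p : ℕ) : Unique (Shuffle p 0 p) where
  default := ⟨Finset.univ, by simp, by simp⟩
  uniq s := μ_injective ((Finset.compl_eq_empty_iff _).1 (Finset.card_eq_zero.1 s.card_ν))

lemma right_of_zero {q : ℕ} (h : Shuffle 0 q q) : h.right = 𝟙 ⦋q⦌ := by
  ext i : 3
  apply Fin.ext
  have h1 := h.left_val_add_right_val i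
  have h2 : (h.left i : Fin (0 + 1)).val < 0 + 1 := Fin.isLt _
  change (h.right i : Fin (q + 1)).val = i.val
  omega

lemma left_of_zero {p : ℕ} (h : Shuffle p 0 p) : h.left = 𝟙 ⦋p⦌ := by
  ext i : 3
  apply Fin.ext
  have h1 := h.left_val_add_right_val i
  have h2 : (h.right i : Fin (0 + 1)).val < 0 + 1 := Fin.isLt _
  change (h.left i : Fin (p + 1)).val = i.val
  omega

lemma inversions_of_left_zero {q : ℕ} (h : Shuffle 0 q q) : h.inversions = 0 := by
  rw [inversions, Finset.card_eq_zero.1 h.card_μ]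
  rfl

lemma inversions_of_right_zero {p : ℕ} (h : Shuffle p 0 p) : h.inversions = 0 := by
  rw [inversions, Finset.card_eq_zero.1 h.card_ν, Finset.product_empty]
  rfl

end Shuffle

section Realization

variable {k : Type v} [Field k] {Z : SimplexCategory ⥤ TopCat.{u}}

namespace NC

lemma coboundary_coboundary (p q : ℕ) (x : NC k Z p q) :
    coboundary k Z p (q + 1) (coboundary k Z p q x) = 0 :=
  Subtype.ext (BenderskyGitler.coboundary_coboundary q x.1)

lemma coboundary_act {p p' : ℕ} (f : ⦋p⦌ ⟶ ⦋p'⦌) (q : ℕ) (x : NC k Z p' q) :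
    coboundary k Z p q (act k Z f q x) = act k Z f (q + 1) (coboundary k Z p' q x) := by
  ext σ
  rfl

lemma act_id (p q : ℕ) (x : NC k Z p q) : act k Z (𝟙 ⦋p⦌) q x = x := by
  ext σ
  change x.1 ((TopCat.toSSet.map (Z.map (𝟙 ⦋p⦌))).app _ σ) = _
  rw [Z.map_id, CategoryTheory.Functor.map_id]
  rfl

lemma face_apply (p q : ℕ) (x : NC k Z (p + 1) q) :
    face k Z p q x = ∑ i : Fin (p + 2), (-1 : k) ^ (i : ℕ) • act k Z (SimplexCategory.δ i) q x := by
  simp [face, LinearMap.sum_apply]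

lemma face_face (p q : ℕ) (x : NC k Z (p + 2) q) : face k Z p q (face k Z (p + 1) q x) = 0 := by
  simp only [face_apply, map_sum, map_smul, Finset.smul_sum, ← act_comp]
  have h := sum_faces_faces (k := k) fun f : ⦋p⦌ ⟶ ⦋p + 2⦌ => act k Z f q x
  simpa only [Finset.smul_sum] using h

lemma coboundary_face (p q : ℕ) (x : NC k Z (p + 1) q) :
    coboundary k Z p q (face k Z p q x) = face k Z p (q + 1) (coboundary k Z (p + 1) q x) := by
  simp only [face_apply, map_sum, map_smul, coboundary_act]

variable (k Z) in
/-- The cup product with values in the cochains of a degree `m` which is equal to `r + s`. -/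
noncomputable def cupAt (n : ℕ) {r s m : ℕ} (h : r + s = m) :
    NC k Z n r →ₗ[k] NC k Z n s →ₗ[k] NC k Z n m :=
  LinearMap.mk₂ k (fun x y => ⟨BenderskyGitler.cupAt h x.1 y.1, cupAt_mem h x.2 y.2⟩)
    (fun _ _ _ => by ext σ; exact add_mul _ _ _) (fun _ _ _ => by ext σ; exact mul_assoc _ _ _)
    (fun _ _ _ => by ext σ; exact mul_add _ _ _) (fun _ _ _ => by ext σ; exact mul_left_comm _ _ _)

lemma act_cupAt {n n' : ℕ} (f : ⦋n⦌ ⟶ ⦋n'⦌) {r s m : ℕ} (h : r + s = m) (x : NC k Z n' r)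
    (y : NC k Z n' s) : act k Z f m (cupAt k Z n' h x y) =
      cupAt k Z n h (act k Z f r x) (act k Z f s y) := by
  ext σ
  rfl

lemma cupAt_assoc (n : ℕ) {p q r pq qr m : ℕ} (h₁ : p + q = pq) (h₂ : pq + r = m)
    (h₃ : q + r = qr) (h₄ : p + qr = m) (x : NC k Z n p) (y : NC k Z n q) (z : NC k Z n r) :
    cupAt k Z n h₂ (cupAt k Z n h₁ x y) z = cupAt k Z n h₄ x (cupAt k Z n h₃ y z) :=
  Subtype.ext (BenderskyGitler.cupAt_assoc h₁ h₂ h₃ h₄ x.1 y.1 z.1)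

lemma coboundary_cupAt (n : ℕ) {r s : ℕ} (x : NC k Z n r) (y : NC k Z n s) :
    coboundary k Z n (r + s) (cupAt k Z n rfl x y) =
      cupAt k Z n (by omega) (coboundary k Z n r x) y +
        (-1 : k) ^ r • cupAt k Z n rfl x (coboundary k Z n s y) :=
  Subtype.ext (coboundary_cup x.1 y.1)

variable (k Z) in
/-- The shuffle product with values in the summand with indices `n` and `m`. -/
noncomputable def shuffleAt (p q n : ℕ) {r s m : ℕ} (h : r + s = m) :
    NC k Z p r →ₗ[k] NC k Z q s →ₗ[k] NC k Z n m :=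
  ∑ g : Shuffle p q n, (-1 : k) ^ g.inversions •
    (cupAt k Z n h).compl₁₂ (act k Z g.left r) (act k Z g.right s)

lemma shuffleAt_apply (p q n : ℕ) {r s m : ℕ} (h : r + s = m) (x : NC k Z p r) (y : NC k Z q s) :
    shuffleAt k Z p q n h x y = ∑ g : Shuffle p q n, (-1 : k) ^ g.inversions •
      cupAt k Z n h (act k Z g.left r x) (act k Z g.right s y) := by
  simp [shuffleAt, LinearMap.sum_apply]

lemma shuffleAt_rfl (p q : ℕ) {r s : ℕ} :
    shuffleAt k Z p q (p + q) (rfl : r + s = r + s) = shuffle k Z p r q s := rfl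

/-- The coboundary commutes with the simplicial operators, so the Leibniz rule of the cup product
applies to every shuffle separately. -/
lemma coboundary_shuffle (p q : ℕ) {r s : ℕ} (x : NC k Z p r) (y : NC k Z q s) :
    coboundary k Z (p + q) (r + s) (shuffle k Z p r q s x y) =
      shuffleAt k Z p q (p + q) (by omega) (coboundary k Z p r x) y +
        (-1 : k) ^ r • shuffle k Z p r q (s + 1) x (coboundary k Z q s y) := by
  simp only [← shuffleAt_rfl, shuffleAt_apply, map_sum, map_smul, coboundary_cupAt, coboundary_act,
    smul_add, Finset.sum_add_distrib, Finset.smul_sum]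
  congr 1
  exact Finset.sum_congr rfl fun g _ => smul_comm _ _ _

lemma face_shuffleAt {p q n r s m : ℕ} (h : r + s = m) (x : NC k Z p r) (y : NC k Z q s) :
    face k Z n m (shuffleAt k Z p q (n + 1) h x y) =
      ∑ g : Shuffle p q (n + 1), (-1 : k) ^ g.inversions •
        ∑ i : Fin (n + 2), (-1 : k) ^ (i : ℕ) •
          cupAt k Z n h (act k Z (SimplexCategory.δ i ≫ g.left) r x)
            (act k Z (SimplexCategory.δ i ≫ g.right) s y) := by
  simp only [shuffleAt_apply, map_sum, map_smul, face_apply, act_cupAt, act_comp]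

lemma shuffleAt_face_left {p q n r s m : ℕ} (h : r + s = m) (x : NC k Z (p + 1) r)
    (y : NC k Z q s) : shuffleAt k Z p q n h (face k Z p r x) y =
      ∑ i : Fin (p + 2), (-1 : k) ^ (i : ℕ) • ∑ g : Shuffle p q n, (-1 : k) ^ g.inversions •
        cupAt k Z n h (act k Z (g.left ≫ SimplexCategory.δ i) r x) (act k Z g.right s y) := by
  simp only [face_apply, map_sum, map_smul, LinearMap.sum_apply, LinearMap.smul_apply,
    shuffleAt_apply, act_comp]

lemma shuffleAt_face_right {p q n r s m : ℕ} (h : r + s = m) (x : NC k Z p r)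
    (y : NC k Z (q + 1) s) : shuffleAt k Z p q n h x (face k Z q s y) =
      ∑ i : Fin (q + 2), (-1 : k) ^ (i : ℕ) • ∑ g : Shuffle p q n, (-1 : k) ^ g.inversions •
        cupAt k Z n h (act k Z g.left r x) (act k Z (g.right ≫ SimplexCategory.δ i) s y) := by
  simp only [face_apply, map_sum, map_smul, shuffleAt_apply, act_comp]

/-- The simplicial operators distribute over cup products, which reduces the claim to associativity
of EZ in the index `p` and of the cup product in the index `q`. -/
lemma shuffleAt_assoc {p q t n r s l rs sl m : ℕ} (hn : n = p + q + t) (h₁ : r + s = rs)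
    (h₂ : rs + l = m) (h₃ : s + l = sl) (h₄ : r + sl = m)
    (x : NC k Z p r) (y : NC k Z q s) (z : NC k Z t l) :
    shuffleAt k Z (p + q) t n h₂ (shuffleAt k Z p q (p + q) h₁ x y) z =
      shuffleAt k Z p (q + t) n h₄ x (shuffleAt k Z q t (q + t) h₃ y z) := by
  have h := sum_shuffle_assoc (k := k) hn fun f g e =>
    cupAt k Z n h₂ (cupAt k Z n h₁ (act k Z f r x) (act k Z g s y)) (act k Z e l z)
  simp only [shuffleAt_apply, map_sum, map_smul, LinearMap.sum_apply, LinearMap.smul_apply,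
    act_cupAt, ← act_comp]
  rw [h]
  simp only [cupAt_assoc n h₁ h₂ h₃ h₄]

end NC

end Realization

/-! ### The algebra axioms for the total complex. -/

namespace realization

variable {k : Type v} [Field k] {Z : SimplexCategory ⥤ TopCat.{u}}

variable (k Z) in
/-- The class in `|NN(Z)|^*` of a normalized `q`-cochain of `Z[p]`. -/
noncomputable def cls (p q : ℕ) : NC k Z p q →ₗ[k] (realization k Z).carrier :=
  NN.incl k Z p q ∘ₗ NN.mk k Z p q

variable (k Z) in
/-- The class of the alternating sum of the faces of a normalized `q`-cochain of `Z[p]`. -/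
noncomputable def clsFace (p q : ℕ) : NC k Z p q →ₗ[k] (realization k Z).carrier :=
  match p with
  | 0 => 0
  | p + 1 => cls k Z p q ∘ₗ NC.face k Z p q

@[elab_as_elim]
lemma induction {P : (realization k Z).carrier → Prop} (x) (h0 : P 0)
    (hl : ∀ p q α, P (cls k Z p q α)) (ha : ∀ x y, P x → P y → P (x + y)) : P x :=
  directSum_lof_induction k (M := fun i : ℕ × ℕ => NN k Z i.1 i.2) x h0
    (fun i y => by
      obtain ⟨α, rfl⟩ := NN.mk_surjective i.1 i.2 y
      exact hl i.1 i.2 α) ha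

lemma cls_mem_deg {n : ℤ} {p q : ℕ} (h : (q : ℤ) - p = n) (α : NC k Z p q) :
    cls k Z p q α ∈ (realization k Z).deg n :=
  lof_mem_graded (k := k) (M := fun i : ℕ × ℕ => NN k Z i.1 i.2) (i := (p, q))
    (fun i => (i.2 : ℤ) - (i.1 : ℤ)) h _

@[elab_as_elim]
lemma deg_induction {n : ℤ} {P : ∀ x, x ∈ (realization k Z).deg n → Prop} {x}
    (hx : x ∈ (realization k Z).deg n) (h0 : P 0 (zero_mem _))
    (hl : ∀ (p q : ℕ) α (h : (q : ℤ) - p = n), P (cls k Z p q α) (cls_mem_deg h α))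
    (ha : ∀ x y hx hy, P x hx → P y hy → P (x + y) (add_mem hx hy)) : P x hx := by
  have h : ∃ hx, P x hx :=
    graded_induction (P := fun x => ∃ hx, P x hx) (M := fun i : ℕ × ℕ => NN k Z i.1 i.2)
      (fun i => (i.2 : ℤ) - (i.1 : ℤ)) ⟨_, h0⟩
      (fun i y h => by
        obtain ⟨α, rfl⟩ := NN.mk_surjective i.1 i.2 y
        exact ⟨_, hl i.1 i.2 α h⟩) (fun x y hx hy => ⟨_, ha x y hx.1 hy.1 hx.2 hy.2⟩) hx
  exact h.2

lemma d_cls (p q : ℕ) (x : NC k Z p q) :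
    (realization k Z).d (cls k Z p q x) =
      (-1 : k) ^ p • (cls k Z p (q + 1) (NC.coboundary k Z p q x) - clsFace k Z p q x) := by
  refine (DirectSum.toModule_lof k (φ := fun i : ℕ × ℕ =>
    (-1 : k) ^ i.1 • (NN.incl k Z i.1 (i.2 + 1) ∘ₗ NN.coboundary k Z i.1 i.2 -
      NN.faceTotal k Z i.1 i.2)) (p, q) (NN.mk k Z p q x)).trans ?_
  cases p <;> rfl

lemma mul_cls {p q n r s m : ℕ} (hn : p + q = n) (hm : r + s = m) (x : NC k Z p r)
    (y : NC k Z q s) :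
    (realization k Z).mul (cls k Z p r x) (cls k Z q s y) =
      ((((q : ℤ) * ((r : ℤ) - p)).negOnePow : ℤ) : k) •
        cls k Z n m (NC.shuffleAt k Z p q n hm x y) := by
  subst hn hm
  refine (directSum_mul_lof (k := k) (M := fun i : ℕ × ℕ => NN k Z i.1 i.2)
    (fun i j => ((j.1 : ℤ) * ((i.2 : ℤ) - (i.1 : ℤ))).negOnePow •
        (NN.shuffle k Z i.1 i.2 j.1 j.2).compr₂ (NN.incl k Z (i.1 + j.1) (i.2 + j.2)))
    (p, r) (q, s) (NN.mk k Z p r x) (NN.mk k Z q s y)).trans ?_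
  dsimp only
  rw [negOnePow_smul k]
  rfl

lemma cls_shuffleAt {p q n r s m : ℕ} (hn : p + q = n) (hm : r + s = m) (x : NC k Z p r)
    (y : NC k Z q s) : cls k Z n m (NC.shuffleAt k Z p q n hm x y) =
      cls k Z (p + q) (r + s) (NC.shuffle k Z p r q s x y) := by
  subst hn hm
  rfl

variable (k Z) in
/-- The unit of `N^*(Z[p])`. -/
def unitCochain (p : ℕ) : NC k Z p 0 := ⟨fun _ => 1, fun σ hσ => by simp at hσ⟩

lemma one_eq : (realization k Z).one = cls k Z 0 0 (unitCochain k Z 0) := rfl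

/-- The class of the shuffle product of the boundary of the first factor with the second one. -/
noncomputable def faceLeft (p q : ℕ) {r s : ℕ} (x : NC k Z p r) (y : NC k Z q s) :
    (realization k Z).carrier :=
  match p, x with
  | 0, _ => 0
  | p + 1, x => cls k Z (p + q) (r + s) (NC.shuffle k Z p r q s (NC.face k Z p r x) y)

/-- The class of the shuffle product of the first factor with the boundary of the second one. -/
noncomputable def faceRight (p q : ℕ) {r s : ℕ} (x : NC k Z p r) (y : NC k Z q s) :
    (realization k Z).carrier :=
  match q, y with
  | 0, _ => 0
  | q + 1, y => cls k Z (p + q) (r + s) (NC.shuffle k Z p r q s x (NC.face k Z q s y))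

/-- The chain map property of EZ makes `∂` a derivation of the shuffle product. The cases `p = 0`
and `q = 0` are separate because `Δ^0` has no faces. -/
lemma clsFace_shuffle (p q : ℕ) {r s : ℕ} (x : NC k Z p r) (y : NC k Z q s) :
    clsFace k Z (p + q) (r + s) (NC.shuffle k Z p r q s x y) =
      faceLeft p q x y + (-1 : k) ^ p • faceRight p q x y := by
  -- `F` is kept opaque so that the identities on shuffles can be instantiated before it is
  -- unfolded.
  have hF {p q n : ℕ} (x : NC k Z p r) (y : NC k Z q s) :
      ∃ F : (⦋n⦌ ⟶ ⦋p⦌) → (⦋n⦌ ⟶ ⦋q⦌) → NC k Z n (r + s), ∀ f g,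
        F f g = NC.cupAt k Z n rfl (NC.act k Z f r x) (NC.act k Z g s y) := ⟨_, fun _ _ => rfl⟩
  obtain _ | p := p <;> obtain _ | q := q
  · simp [faceLeft, faceRight, clsFace]
  · obtain ⟨F, hF⟩ := hF (n := 0 + q) x y
    have h := sum_shuffle_faces_left_zero (k := k) (n := 0 + q) (by omega) F
    simp only [hF] at h
    rw [← NC.face_shuffleAt, ← NC.shuffleAt_face_right] at h
    change cls k Z (0 + q) (r + s) (NC.face k Z (0 + q) (r + s)
      (NC.shuffleAt k Z 0 (q + 1) (0 + q + 1) rfl x y)) = _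
    rw [h, pow_zero, one_smul]
    exact (zero_add (faceRight 0 (q + 1) x y)).symm
  · obtain ⟨F, hF⟩ := hF (n := p) x y
    have h := sum_shuffle_faces_right_zero (k := k) (n := p) rfl F
    simp only [hF] at h
    rw [← NC.face_shuffleAt, ← NC.shuffleAt_face_left] at h
    change cls k Z p (r + s) (NC.face k Z p (r + s)
      (NC.shuffleAt k Z (p + 1) 0 (p + 1) rfl x y)) = _
    rw [h, faceRight, smul_zero, add_zero]
    rfl
  · obtain ⟨F, hF⟩ := hF (n := p + 1 + q) x y
    have h := sum_shuffle_faces (k := k) (n := p + 1 + q) (by omega) F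
    simp only [hF] at h
    rw [← NC.face_shuffleAt, ← NC.shuffleAt_face_left, ← NC.shuffleAt_face_right] at h
    change cls k Z (p + 1 + q) (r + s) (NC.face k Z (p + 1 + q) (r + s)
      (NC.shuffleAt k Z (p + 1) (q + 1) (p + 1 + q + 1) rfl x y)) = _
    rw [h, map_add, map_smul, cls_shuffleAt (by omega), cls_shuffleAt rfl]
    rfl

lemma mul_clsFace_left (p q : ℕ) {r s : ℕ} (x : NC k Z p r) (y : NC k Z q s) :
    (realization k Z).mul (clsFace k Z p r x) (cls k Z q s y) =
      ((((q : ℤ) * ((r : ℤ) - p + 1)).negOnePow : ℤ) : k) • faceLeft p q x y := by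
  cases p with
  | zero => simp [clsFace, faceLeft]
  | succ p =>
    refine (mul_cls rfl rfl _ _).trans ?_
    rw [cls_shuffleAt rfl]
    congr 5
    push_cast
    ring

lemma mul_clsFace_right (p q : ℕ) {r s : ℕ} (x : NC k Z p r) (y : NC k Z q s) :
    (realization k Z).mul (cls k Z p r x) (clsFace k Z q s y) =
      (((((q : ℤ) + 1) * ((r : ℤ) - p)).negOnePow : ℤ) : k) • faceRight p q x y := by
  cases q with
  | zero => simp [clsFace, faceRight]
  | succ q =>
    refine (mul_cls rfl rfl _ _).trans ?_
    rw [cls_shuffleAt rfl]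
    congr 3
    rw [Int.negOnePow_eq_iff]
    push_cast
    -- Taking a face lowers `q` by one; the exponent with `q + 1` in place of `q - 1` differs by an
    -- even number.
    exact ⟨-((r : ℤ) - p), by ring⟩

protected lemma mul_mem (m n : ℤ) (x y : (realization k Z).carrier)
    (hx : x ∈ (realization k Z).deg m) (hy : y ∈ (realization k Z).deg n) :
    (realization k Z).mul x y ∈ (realization k Z).deg (m + n) := by
  induction hx using deg_induction with
  | h0 => simp
  | ha x x' _ _ h h' => rw [map_add, LinearMap.add_apply]; exact add_mem h h'
  | hl p r α hp =>
    induction hy using deg_induction with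
    | h0 => simp
    | ha y y' _ _ h h' => rw [map_add]; exact add_mem h h'
    | hl q s β hq =>
      rw [mul_cls rfl rfl]
      exact Submodule.smul_mem _ _ (cls_mem_deg (by push_cast; omega) _)

lemma d_mem (n : ℤ) (x : (realization k Z).carrier) (hx : x ∈ (realization k Z).deg n) :
    (realization k Z).d x ∈ (realization k Z).deg (n + 1) := by
  induction hx using deg_induction with
  | h0 => simp
  | ha x x' _ _ h h' => rw [map_add]; exact add_mem h h'
  | hl p q α hp =>
    rw [d_cls]
    refine Submodule.smul_mem _ _ (sub_mem (cls_mem_deg (by push_cast; omega) _) ?_)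
    cases p with
    | zero => exact zero_mem _
    | succ p => exact cls_mem_deg (by push_cast at hp; omega) _

protected lemma one_mul (x : (realization k Z).carrier) :
    (realization k Z).mul (realization k Z).one x = x := by
  induction x using induction with
  | h0 => simp
  | ha x x' h h' => rw [map_add, h, h']
  | hl p q α =>
    rw [one_eq, mul_cls (zero_add p) (zero_add q)]
    simp only [Nat.cast_zero, sub_self, mul_zero, Int.negOnePow_zero, Units.val_one, Int.cast_one,
      one_smul]
    congr 1
    rw [NC.shuffleAt_apply, Fintype.sum_unique, Shuffle.inversions_of_left_zero, pow_zero, one_smul,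
      Shuffle.right_of_zero, NC.act_id]
    ext σ
    change 1 * α.1 _ = _
    rw [subinterval_self, one_mul, op_id, CategoryTheory.Functor.map_id]
    rfl

protected lemma mul_one (x : (realization k Z).carrier) :
    (realization k Z).mul x (realization k Z).one = x := by
  induction x using induction with
  | h0 => simp
  | ha x x' h h' => rw [map_add, LinearMap.add_apply, h, h']
  | hl p q α =>
    rw [one_eq, mul_cls (add_zero p) (add_zero q)]
    simp only [Nat.cast_zero, zero_mul, Int.negOnePow_zero, Units.val_one, Int.cast_one, one_smul]
    congr 1
    rw [NC.shuffleAt_apply, Fintype.sum_unique, Shuffle.inversions_of_right_zero, pow_zero, one_smul,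
      Shuffle.left_of_zero, NC.act_id]
    ext σ
    change α.1 _ * 1 = _
    rw [subinterval_self, mul_one, op_id, CategoryTheory.Functor.map_id]
    rfl

protected lemma mul_assoc (x y z : (realization k Z).carrier) :
    (realization k Z).mul ((realization k Z).mul x y) z =
      (realization k Z).mul x ((realization k Z).mul y z) := by
  induction x using induction with
  | h0 => simp
  | ha x x' h h' => simp only [map_add, LinearMap.add_apply, h, h']
  | hl p r α =>
    induction y using induction with
    | h0 => simp
    | ha x x' h h' => simp only [map_add, LinearMap.add_apply, h, h']
    | hl q s β =>
      induction z using induction with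
      | h0 => simp
      | ha x x' h h' => simp only [map_add, h, h']
      | hl t l γ =>
        rw [mul_cls rfl rfl, mul_cls rfl rfl, map_smul, map_smul, LinearMap.smul_apply,
          mul_cls rfl rfl, mul_cls (add_assoc p q t).symm (add_assoc r s l).symm,
          NC.shuffleAt_assoc rfl rfl rfl rfl (add_assoc r s l).symm, smul_smul, smul_smul]
        congr 1
        rw [← Int.cast_mul, ← Int.cast_mul, ← Units.val_mul, ← Units.val_mul,
          ← Int.negOnePow_add, ← Int.negOnePow_add]
        -- The Koszul exponents of the two bracketings agree as integers, not only modulo two.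
        congr 3
        push_cast
        ring

lemma d_d (x : (realization k Z).carrier) : (realization k Z).d ((realization k Z).d x) = 0 := by
  induction x using induction with
  | h0 => simp
  | ha x x' h h' => simp only [map_add, h, h', add_zero]
  | hl p q α =>
    -- As `∂∂ = 0`, only the mixed term survives; the sign comes from index `p - 1` and makes it
    -- cancel the mixed term of `d (δ α)`.
    have h1 : (realization k Z).d (clsFace k Z p q α) =
        -(-1 : k) ^ p • clsFace k Z p (q + 1) (NC.coboundary k Z p q α) := by
      cases p with
      | zero => simp [clsFace]
      | succ p =>
        refine (d_cls p q (NC.face k Z p q α)).trans ?_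
        have h2 : clsFace k Z p q (NC.face k Z p q α) = 0 := by
          cases p with
          | zero => rfl
          | succ p => exact (congrArg (cls k Z p q) (NC.face_face p q α)).trans (map_zero _)
        rw [h2, NC.coboundary_face, sub_zero, pow_succ, mul_neg_one, neg_neg]
        rfl
    rw [d_cls, map_smul, map_sub, h1, d_cls, NC.coboundary_coboundary, map_zero]
    simp

lemma leibniz (n : ℤ) (x y : (realization k Z).carrier) (hx : x ∈ (realization k Z).deg n) :
    (realization k Z).d ((realization k Z).mul x y) =
      (realization k Z).mul ((realization k Z).d x) y +
        n.negOnePow • (realization k Z).mul x ((realization k Z).d y) := by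
  induction hx using deg_induction with
  | h0 => simp
  | ha x x' _ _ h h' =>
    simp only [map_add, LinearMap.add_apply, h, h', smul_add]
    abel
  | hl p r α hp =>
    induction y using induction with
    | h0 => simp
    | ha x x' h h' =>
      simp only [map_add, h, h', smul_add]
      abel
    | hl q s β =>
      subst hp
      have e₁ : ((((r : ℤ) - p).negOnePow : ℤ) : k) = (-1) ^ r * (-1) ^ p := by
        rw [Int.negOnePow_sub, Units.val_mul, Int.cast_mul, Int.cast_negOnePow_natCast,
          Int.cast_negOnePow_natCast]
      have e₂ : (((q : ℤ) * ((r : ℤ) - p + 1)).negOnePow : ℤ) =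
          (((q : ℤ) * ((r : ℤ) - p)).negOnePow : ℤ) * (-1) ^ q := by
        rw [mul_add, mul_one, Int.negOnePow_add, Units.val_mul, Int.coe_negOnePow_natCast]
      have e₃ : ((((q : ℤ) + 1) * ((r : ℤ) - p)).negOnePow : ℤ) =
          (((q : ℤ) * ((r : ℤ) - p)).negOnePow : ℤ) * (((r : ℤ) - p).negOnePow : ℤ) := by
        rw [add_mul, one_mul, Int.negOnePow_add, Units.val_mul]
      have e₄ : ((r + 1 : ℕ) : ℤ) - p = (r : ℤ) - p + 1 := by push_cast; ring
      have hr : (-1 : k) ^ r * (-1) ^ r = 1 := by rw [← mul_pow]; simp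
      rw [mul_cls rfl rfl, map_smul, NC.shuffleAt_rfl, d_cls, NC.coboundary_shuffle, clsFace_shuffle,
        d_cls, d_cls, map_smul, map_smul, map_sub, map_sub, LinearMap.smul_apply, LinearMap.sub_apply,
        mul_clsFace_left, mul_clsFace_right, mul_cls rfl rfl, mul_cls rfl rfl,
        map_add, map_smul, cls_shuffleAt rfl, cls_shuffleAt rfl, cls_shuffleAt rfl,
        negOnePow_smul k, e₄, e₂, e₃, Int.cast_mul, Int.cast_mul, e₁]
      push_cast
      generalize ((((q : ℤ) * ((r : ℤ) - p)).negOnePow : ℤ) : k) = N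
      rw [pow_add]
      generalize (-1 : k) ^ p = a
      generalize (-1 : k) ^ q = b
      generalize (-1 : k) ^ r = c at *
      match_scalars
      · ring
      · ring
      · ring
      -- The coefficient of `faceRight`: `(-1)^r` enters once through the degree of `x` and once
      -- through the Koszul sign of its product with `∂y`.
      · linear_combination N * b * a ^ 2 * hr

lemma isInternal_deg : DirectSum.IsInternal (realization k Z).deg :=
  isInternal_graded (k := k) (M := fun i : ℕ × ℕ => NN k Z i.1 i.2)
    (fun i => (i.2 : ℤ) - (i.1 : ℤ))

lemma one_mem : (realization k Z).one ∈ (realization k Z).deg 0 := by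
  rw [one_eq]
  exact cls_mem_deg (by simp) _

theorem isDGAlgebra : (realization k Z).IsDGAlgebra where
  isInternal := isInternal_deg
  one_mem := one_mem
  mul_mem := realization.mul_mem
  d_mem := d_mem
  one_mul := realization.one_mul
  mul_one := realization.mul_one
  mul_assoc := realization.mul_assoc
  d_d := d_d
  leibniz := leibniz

end realization

/-! ### The comparison map -/

section Comparison

variable {k : Type v} [Field k] {Z W : SimplexCategory ⥤ TopCat.{u}}

/-- The value of a cochain of `Z[p]` on the image by the evaluation map of the product of a
degeneracy of the fundamental simplex and a simplex of `‖Z‖`. -/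
noncomputable def evalAt {p q : ℕ} (x : NC k Z p q) (f : ⦋q⦌ ⟶ ⦋p⦌)
    (w : TopCat.toSSet.obj (geometricRealization Z) _⦋q⦌) : k :=
  x.1 ((TopCat.toSSet.map (evaluation Z p)).app (op ⦋q⦌)
    (prodSimplex ((TopCat.toSSet.obj _).map f.op (fundamentalSimplex p)) w))

lemma evalAt_sum {p q : ℕ} {ι : Type*} [Fintype ι] (c : ι → k) (x : ι → NC k Z p q)
    (f : ⦋q⦌ ⟶ ⦋p⦌) (w : TopCat.toSSet.obj (geometricRealization Z) _⦋q⦌) :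
    evalAt (∑ i, c i • x i) f w = ∑ i, c i * evalAt (x i) f w := by
  simp [evalAt]

/-- Points of `‖Z‖` commute with the cosimplicial operators, so `g` passes from the cochain to the
simplex of `Δ^{p'}`. -/
lemma evalAt_act {p p' q : ℕ} (g : ⦋p⦌ ⟶ ⦋p'⦌) (x : NC k Z p' q) (f : ⦋q⦌ ⟶ ⦋p⦌)
    (w : TopCat.toSSet.obj (geometricRealization Z) _⦋q⦌) :
    evalAt (NC.act k Z g q x) f w = evalAt x (f ≫ g) w :=
  congrArg x.1 (evaluation_simplex f g w)

lemma evaluation_map {p q q' : ℕ} (g : ⦋q'⦌ ⟶ ⦋q⦌) (f : ⦋q⦌ ⟶ ⦋p⦌)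
    (w : TopCat.toSSet.obj (geometricRealization Z) _⦋q⦌) :
    (TopCat.toSSet.obj (Z.obj ⦋p⦌)).map g.op ((TopCat.toSSet.map (evaluation Z p)).app (op ⦋q⦌)
      (prodSimplex ((TopCat.toSSet.obj _).map f.op (fundamentalSimplex p)) w)) =
    (TopCat.toSSet.map (evaluation Z p)).app (op ⦋q'⦌)
      (prodSimplex ((TopCat.toSSet.obj _).map (g ≫ f).op (fundamentalSimplex p))
        ((TopCat.toSSet.obj _).map g.op w)) := by
  rw [op_comp, Functor.map_comp_apply]
  rfl

lemma evalAt_coboundary {p q : ℕ} (x : NC k Z p q) (f : ⦋q + 1⦌ ⟶ ⦋p⦌)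
    (w : TopCat.toSSet.obj (geometricRealization Z) _⦋q + 1⦌) :
    evalAt (NC.coboundary k Z p q x) f w = ∑ i : Fin (q + 2), (-1 : k) ^ (i : ℕ) *
      evalAt x (SimplexCategory.δ i ≫ f)
        ((TopCat.toSSet.obj _).map (SimplexCategory.δ i).op w) := by
  change ∑ i : Fin (q + 2), (-1 : k) ^ (i : ℕ) *
    x.1 ((TopCat.toSSet.obj (Z.obj ⦋p⦌)).map (SimplexCategory.δ i).op _) = _
  exact Finset.sum_congr rfl fun i _ => congrArg (fun σ => (-1 : k) ^ (i : ℕ) * x.1 σ)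
    (evaluation_map (SimplexCategory.δ i) f w)

lemma evalAt_cup {p r s : ℕ} (x : NC k Z p r) (y : NC k Z p s) (f : ⦋r + s⦌ ⟶ ⦋p⦌)
    (w : TopCat.toSSet.obj (geometricRealization Z) _⦋r + s⦌) :
    evalAt (NC.cup k Z p r s x y) f w =
      evalAt x (front r s ≫ f) ((TopCat.toSSet.obj _).map (front r s).op w) *
        evalAt y (back r s ≫ f) ((TopCat.toSSet.obj _).map (back r s).op w) :=
  congrArg₂ (fun σ τ => x.1 σ * y.1 τ) (evaluation_map (front r s) f w)
    (evaluation_map (back r s) f w)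

/-- Both components collapse the same step `t`, so their product simplex is degenerate, and `x` is
normalized. -/
lemma evalAt_eq_zero {p q m : ℕ} (x : NC k Z p q) (f : ⦋q⦌ ⟶ ⦋p⦌) (g : ⦋q⦌ ⟶ ⦋m⦌)
    (w : TopCat.toSSet.obj (geometricRealization Z) _⦋m⦌) (t : Fin q)
    (hf : f t.castSucc = f t.succ) (hg : g t.castSucc = g t.succ) :
    evalAt x f ((TopCat.toSSet.obj _).map g.op w) = 0 := by
  refine x.2 _ (SSet.degenerate_app_apply ?_ _)
  cases q with
  | zero => exact t.elim0
  | succ q =>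
    obtain ⟨f, rfl⟩ := SimplexCategory.eq_σ_comp_of_not_injective' f t hf
    obtain ⟨g, rfl⟩ := SimplexCategory.eq_σ_comp_of_not_injective' g t hg
    refine ⟨q, by omega, SimplexCategory.σ t, prodSimplex
      ((TopCat.toSSet.obj _).map f.op (fundamentalSimplex p))
      ((TopCat.toSSet.obj _).map g.op w), ?_⟩
    rw [op_comp, op_comp, Functor.map_comp_apply, Functor.map_comp_apply]
    rfl

/-- The slant product with the fundamental simplex, with values in the cochains of degree `s`. -/
noncomputable def integrateAt {p q : ℕ} (s : ℕ) (x : NC k Z p q) :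
    Cochain k (TopCat.toSSet.obj (geometricRealization Z)) s := fun w =>
  ∑ h : Shuffle p s q, (-1 : k) ^ h.inversions *
    evalAt x h.left ((TopCat.toSSet.obj _).map h.right.op w)

lemma integrate_eq (p q : ℕ) (x : NC k Z p q) : NC.integrate k Z p q x = integrateAt (q - p) x := by
  funext w
  exact slant_apply _ _ _

lemma integrateAt_eq_zero {p q s : ℕ} (h : q ≠ p + s) (x : NC k Z p q) : integrateAt s x = 0 := by
  funext w
  refine Finset.sum_eq_zero fun g _ => absurd ?_ h
  have h := Finset.card_add_card_compl g.μ
  rw [g.card_μ, g.card_ν, Fintype.card_fin] at h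
  exact h.symm

lemma comparison_cls {p q : ℕ} (s : ℕ) (h : q - p = s) (x : NC k Z p q) :
    comparison k Z (realization.cls k Z p q x) =
      singularCochains.incl k (geometricRealization Z) s (integrateAt s x) := by
  subst h
  rw [← integrate_eq]
  exact DirectSum.toModule_lof k (φ := fun i : ℕ × ℕ =>
    DirectSum.lof k ℕ (fun n => Cochain k (TopCat.toSSet.obj (geometricRealization Z)) n)
      (i.2 - i.1) ∘ₗ NN.lift (NC.integrate k Z i.1 i.2) fun _ hx => NC.integrate_D _ _ hx)
    (p, q) (NN.mk k Z p q x)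

/-- The truncated difference `q - p` is `0` here, but there are no `(p, 0)`-shuffles of `q` steps.
-/
lemma comparison_cls_of_lt {p q : ℕ} (h : q < p) (x : NC k Z p q) :
    comparison k Z (realization.cls k Z p q x) = 0 := by
  rw [comparison_cls 0 (by omega), integrateAt_eq_zero (by omega), map_zero]

/-- If `w` collapses step `j`, then at the step where `h.right` crosses `j` both components of the
product simplex are constant. -/
lemma integrateAt_mem {p q s : ℕ} (x : NC k Z p q) :
    integrateAt s x ∈ normalized k (TopCat.toSSet.obj (geometricRealization Z)) s := by
  intro w hw
  obtain ⟨m, f, τ, j, rfl, hj⟩ := exists_adjacent_of_mem_degenerate _ hw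
  refine Finset.sum_eq_zero fun h _ => mul_eq_zero_of_right _ ?_
  obtain ⟨t, ht, h₁, h₂⟩ := exists_climb_step h.μᶜ h.card_ν j
  rw [← Functor.map_comp_apply, ← op_comp]
  refine evalAt_eq_zero x h.left (h.right ≫ f) τ t (climb_flat _ _ (by simpa using ht)) ?_
  change f (h.right t.castSucc) = f (h.right t.succ)
  rw [Shuffle.right, h₁, h₂, hj]

lemma comparison_mem_normalized (x : (realization k Z).carrier) :
    comparison k Z x ∈ normalizedSingularCochains k (geometricRealization Z) := by
  induction x using realization.induction with
  | h0 => rw [map_zero]; exact zero_mem _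
  | ha x y hx hy => rw [map_add]; exact add_mem hx hy
  | hl p q x =>
    rw [comparison_cls _ rfl]
    exact Submodule.mem_iSup_of_mem (q - p) ⟨_, integrateAt_mem x, rfl⟩

lemma comparison_map (F : Z ⟶ W) (x : (realization k W).carrier) :
    comparison k Z (realization.map F x) =
      singularCochains.map k (geometricRealization.map F) (comparison k W x) := by
  induction x using realization.induction with
  | h0 => simp only [map_zero]
  | ha x y hx hy => simp only [map_add, hx, hy]
  | hl p q x =>
    have h₁ : realization.map F (realization.cls k W p q x) =
        realization.cls k Z p q (NC.map F p q x) :=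
      DirectSum.toModule_lof k (φ := fun i : ℕ × ℕ => NN.incl k Z i.1 i.2 ∘ₗ
        NN.lift (NN.mk k Z i.1 i.2 ∘ₗ NC.map F i.1 i.2)
          fun _ hx => NN.mk_eq_zero (NC.map_D F _ _ hx)) (p, q) (NN.mk k W p q x)
    have h₂ (n : ℕ) (α : Cochain k (TopCat.toSSet.obj (geometricRealization W)) n) :
        singularCochains.map k (geometricRealization.map F)
          (singularCochains.incl k (geometricRealization W) n α) =
        singularCochains.incl k (geometricRealization Z) n
          (pullback k (TopCat.toSSet.map (geometricRealization.map F)) n α) :=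
      DirectSum.toModule_lof k (φ := fun n =>
        DirectSum.lof k ℕ (fun n => Cochain k (TopCat.toSSet.obj (geometricRealization Z)) n) n ∘ₗ
          pullback k (TopCat.toSSet.map (geometricRealization.map F)) n) n α
    rw [h₁, comparison_cls _ rfl, comparison_cls _ rfl, h₂]
    congr 1

lemma comparison_one : comparison k Z (realization k Z).one =
    (singularCochains k (geometricRealization Z)).one := by
  rw [realization.one_eq, comparison_cls 0 rfl, singularCochains.one_eq]
  congr 1
  funext w
  refine (Fintype.sum_unique _).trans ?_
  rw [Shuffle.inversions_of_left_zero, pow_zero, one_mul]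
  rfl

lemma comparison_mem_deg (n : ℤ) (x : (realization k Z).carrier)
    (hx : x ∈ (realization k Z).deg n) :
    comparison k Z x ∈ (singularCochains k (geometricRealization Z)).deg n := by
  induction hx using realization.deg_induction with
  | h0 => rw [map_zero]; exact zero_mem _
  | ha x y _ _ hx hy => rw [map_add]; exact add_mem hx hy
  | hl p q x h =>
    rcases lt_or_ge q p with hqp | hqp
    · rw [comparison_cls_of_lt hqp]
      exact zero_mem _
    · rw [comparison_cls _ rfl]
      exact singularCochains.incl_mem_deg (by omega) _

/-! ### Compatibility with the differentials. -/

lemma integrateAt_coboundary {p q s : ℕ} (x : NC k Z p q)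
    (w : TopCat.toSSet.obj (geometricRealization Z) _⦋s⦌) :
    integrateAt s (NC.coboundary k Z p q x) w =
      ∑ h : Shuffle p s (q + 1), (-1 : k) ^ h.inversions •
        ∑ i : Fin (q + 2), (-1 : k) ^ (i : ℕ) • evalAt x (SimplexCategory.δ i ≫ h.left)
          ((TopCat.toSSet.obj _).map (SimplexCategory.δ i ≫ h.right).op w) := by
  simp only [op_comp, Functor.map_comp_apply, integrateAt, evalAt_coboundary, smul_eq_mul]

lemma integrateAt_face {p q s : ℕ} (x : NC k Z (p + 1) q)
    (w : TopCat.toSSet.obj (geometricRealization Z) _⦋s⦌) :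
    integrateAt s (NC.face k Z p q x) w =
      ∑ i : Fin (p + 2), (-1 : k) ^ (i : ℕ) • ∑ h : Shuffle p s q, (-1 : k) ^ h.inversions •
        evalAt x (h.left ≫ SimplexCategory.δ i) ((TopCat.toSSet.obj _).map h.right.op w) := by
  simp only [integrateAt, NC.face_apply, evalAt_sum, evalAt_act, smul_eq_mul, Finset.mul_sum]
  rw [Finset.sum_comm]
  exact Finset.sum_congr rfl fun i _ => Finset.sum_congr rfl fun h _ => mul_left_comm _ _ _

/-- Stokes' formula for integration along `Δ^p`: the faces of `Δ^p × w` lie over the faces of `Δ^p`,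
which give `∂x`, or over the faces of `w`, which give the coboundary of the integral. -/
lemma coboundary_integrateAt {p q s : ℕ} (hq : q = p + s) (x : NC k Z p q) :
    singularCochains.incl k _ (s + 1) (coboundary k _ s (integrateAt s x)) =
      (-1 : k) ^ p • (singularCochains.incl k _ (s + 1)
        (integrateAt (s + 1) (NC.coboundary k Z p q x)) -
          comparison k Z (realization.clsFace k Z p q x)) := by
  have hsq (p : ℕ) : (-1 : k) ^ p * (-1) ^ p = 1 := by rw [← mul_pow]; simp
  have hδ (w : TopCat.toSSet.obj (geometricRealization Z) _⦋s + 1⦌) :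
      coboundary k _ s (integrateAt s x) w =
        ∑ i : Fin (s + 2), (-1 : k) ^ (i : ℕ) • ∑ h : Shuffle p s q, (-1 : k) ^ h.inversions •
          evalAt x h.left ((TopCat.toSSet.obj _).map (h.right ≫ SimplexCategory.δ i).op w) := by
    simp only [op_comp, Functor.map_comp_apply]
    rfl
  cases p with
  | zero =>
    change _ = (-1 : k) ^ 0 • (_ - comparison k Z 0)
    rw [map_zero, sub_zero, pow_zero, one_smul]
    congr 1
    funext w
    rw [hδ, integrateAt_coboundary]
    exact (sum_shuffle_faces_left_zero (by omega) fun f g =>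
      evalAt x f ((TopCat.toSSet.obj _).map g.op w)).symm
  | succ p =>
    change _ = (-1 : k) ^ (p + 1) • (_ - comparison k Z (realization.cls k Z p q (NC.face k Z p q x)))
    rw [comparison_cls (s + 1) (by omega), ← map_sub, ← map_smul]
    congr 1
    funext w
    have h := sum_shuffle_faces (k := k) (p := p) (q := s) (n := q) (by omega) fun f g =>
      evalAt x f ((TopCat.toSSet.obj _).map g.op w)
    rw [← integrateAt_coboundary, ← integrateAt_face, ← hδ] at h
    change _ = (-1 : k) ^ (p + 1) * (_ - _)
    rw [h, add_sub_cancel_left, smul_eq_mul, ← mul_assoc, hsq, one_mul]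

lemma comparison_d (x : (realization k Z).carrier) :
    comparison k Z ((realization k Z).d x) =
      (singularCochains k (geometricRealization Z)).d (comparison k Z x) := by
  induction x using realization.induction with
  | h0 => simp only [map_zero]
  | ha x y hx hy => simp only [map_add, hx, hy]
  | hl p q x =>
    rw [realization.d_cls, map_smul, map_sub]
    rcases lt_or_ge q p with hqp | hqp
    · rw [comparison_cls_of_lt hqp, map_zero]
      obtain ⟨p, rfl⟩ : ∃ p', p = p' + 1 := ⟨p - 1, by omega⟩
      change _ • (_ - comparison k Z (realization.cls k Z p q (NC.face k Z p q x))) = _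
      -- Although `x` integrates to zero, `δx` and `∂x` need not when the total degree of `x` is
      -- `-1`. Both then give `0`-cochains, equal by Stokes' formula over a point; in lower degrees
      -- both vanish.
      rcases eq_or_lt_of_le (Nat.le_of_lt_succ hqp) with rfl | hlt
      · have h : integrateAt 0 (NC.coboundary k Z (q + 1) q x) =
            integrateAt 0 (NC.face k Z q q x) := by
          funext w
          rw [integrateAt_coboundary, integrateAt_face]
          exact sum_shuffle_faces_right_zero rfl fun f g =>
            evalAt x f ((TopCat.toSSet.obj _).map g.op w)
        rw [comparison_cls 0 (by omega), comparison_cls 0 (by omega), h, sub_self, smul_zero]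
      · rw [comparison_cls_of_lt (by omega), comparison_cls_of_lt hlt, sub_zero, smul_zero]
    · rw [comparison_cls (q - p + 1) (by omega), comparison_cls (q - p) rfl, singularCochains.d_incl,
        coboundary_integrateAt (by omega)]

/-! ### Compatibility with the products. -/

lemma integrateAt_shuffle {p q r s c : ℕ} (x : NC k Z p r) (y : NC k Z q s)
    (w : TopCat.toSSet.obj (geometricRealization Z) _⦋c⦌) :
    integrateAt c (NC.shuffle k Z p r q s x y) w =
      ∑ hg : Shuffle p q (p + q) × Shuffle (p + q) c (r + s),
        (-1 : k) ^ hg.2.inversions * ((-1 : k) ^ hg.1.inversions *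
          (evalAt x (front r s ≫ hg.2.left ≫ hg.1.left)
              ((TopCat.toSSet.obj _).map (front r s ≫ hg.2.right).op w) *
            evalAt y (back r s ≫ hg.2.left ≫ hg.1.right)
              ((TopCat.toSSet.obj _).map (back r s ≫ hg.2.right).op w))) := by
  rw [Fintype.sum_prod_type_right]
  simp only [integrateAt, NC.shuffle_apply, evalAt_sum, evalAt_cup, evalAt_act, Finset.mul_sum,
    op_comp, Functor.map_comp_apply, Category.assoc]

lemma eq_initial_of_evalAt_ne_zero {p q r s c : ℕ} (x : NC k Z p r) (y : NC k Z q s)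
    (w : TopCat.toSSet.obj (geometricRealization Z) _⦋c⦌) (h : Shuffle p q (p + q))
    (g : Shuffle (p + q) c (r + s))
    (hx : evalAt x (front r s ≫ g.left ≫ h.left)
      ((TopCat.toSSet.obj _).map (front r s ≫ g.right).op w) ≠ 0)
    (hy : evalAt y (back r s ≫ g.left ≫ h.right)
      ((TopCat.toSSet.obj _).map (back r s ≫ g.right).op w) ≠ 0) :
    h = Shuffle.initial p q ∧ (g.left (front r s (Fin.last r)) : Fin _).val = p :=
  Shuffle.eq_initial_of_not_flat h g (fun t ht => hx (evalAt_eq_zero x _ _ w t ht.1 ht.2))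
    fun t ht => hy (evalAt_eq_zero y _ _ w t ht.1 ht.2)

/-- A contributing `g` climbs `p` levels in its first `r` steps and `q` levels in the remaining `s`,
which is impossible here. -/
lemma integrateAt_shuffle_eq_zero {p q r s c : ℕ} (h : r < p ∨ s < q) (x : NC k Z p r)
    (y : NC k Z q s) : integrateAt c (NC.shuffle k Z p r q s x y) = 0 := by
  funext w
  rw [integrateAt_shuffle]
  refine Finset.sum_eq_zero fun hg _ => ?_
  by_contra hne
  have h' := eq_initial_of_evalAt_ne_zero x y w hg.1 hg.2 (fun h0 => hne (by rw [h0]; ring))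
    fun h0 => hne (by rw [h0]; ring)
  have := Shuffle.le_of_left_front_last hg.2 h'.2
  omega

/-- The only contributing pairs are those of `initial p q` with a concatenation, and each is the
product of a term for `x` and a term for `y`, up to the `q * a` crossings between the two halves. -/
lemma integrateAt_shuffle_eq_cup {p q a b : ℕ} (x : NC k Z p (p + a)) (y : NC k Z q (q + b)) :
    integrateAt (a + b) (NC.shuffle k Z p (p + a) q (q + b) x y) =
      (-1 : k) ^ (q * a) • cup k _ a b (integrateAt a x) (integrateAt b y) := by
  funext w
  rw [integrateAt_shuffle]
  have hr : (cup k _ a b (integrateAt a x) (integrateAt b y)) w =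
      ∑ g : Shuffle p a (p + a) × Shuffle q b (q + b),
        ((-1 : k) ^ g.1.inversions * evalAt x g.1.left
          ((TopCat.toSSet.obj _).map (g.1.right ≫ front a b).op w)) *
        ((-1 : k) ^ g.2.inversions * evalAt y g.2.left
          ((TopCat.toSSet.obj _).map (g.2.right ≫ back a b).op w)) := by
    rw [Fintype.sum_prod_type]
    simp only [op_comp, Functor.map_comp_apply]
    exact Finset.sum_mul_sum _ _ _ _
  change _ = (-1 : k) ^ (q * a) * _
  rw [hr, Finset.mul_sum]
  symm
  refine Fintype.sum_of_injective
    (fun g : Shuffle p a (p + a) × Shuffle q b (q + b) =>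
      (Shuffle.initial p q, Shuffle.append g.1 g.2))
    (fun g g' h => Shuffle.append_injective (Prod.ext_iff.1 h).2) _ _ (fun hg hhg => ?_) fun g => ?_
  · by_contra hne
    obtain ⟨h₁, h₂⟩ := eq_initial_of_evalAt_ne_zero x y w hg.1 hg.2
      (fun h0 => hne (by rw [h0]; ring)) fun h0 => hne (by rw [h0]; ring)
    obtain ⟨g₁, g₂, h₃⟩ := Shuffle.exists_append rfl rfl hg.2 h₂
    exact hhg ⟨(g₁, g₂), Prod.ext h₁.symm h₃⟩
  · dsimp only
    rw [Shuffle.inversions_initial, Shuffle.inversions_append, Shuffle.front_append_left,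
      Shuffle.front_append_right, Shuffle.back_append_left, Shuffle.back_append_right]
    ring

lemma comparison_mul (x y : (realization k Z).carrier) :
    comparison k Z ((realization k Z).mul x y) =
      (singularCochains k (geometricRealization Z)).mul (comparison k Z x) (comparison k Z y) := by
  induction x using realization.induction with
  | h0 => simp only [map_zero, LinearMap.zero_apply]
  | ha x x' h h' => simp only [map_add, LinearMap.add_apply, h, h']
  | hl p r x =>
    induction y using realization.induction with
    | h0 => simp only [map_zero]
    | ha y y' h h' => simp only [map_add, h, h']
    | hl q s y =>
      rw [realization.mul_cls rfl rfl, NC.shuffleAt_rfl, map_smul]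
      -- One factor can have negative degree while the product has degree at least zero, so the
      -- vanishing of the left-hand side is not a matter of degrees.
      by_cases hc : r < p ∨ s < q
      · rw [comparison_cls _ rfl, integrateAt_shuffle_eq_zero hc, map_zero, smul_zero]
        rcases hc with hc | hc
        · rw [comparison_cls_of_lt hc, map_zero, LinearMap.zero_apply]
        · rw [comparison_cls_of_lt hc, map_zero]
      · obtain ⟨a, rfl⟩ : ∃ a, r = p + a := ⟨r - p, by omega⟩
        obtain ⟨b, rfl⟩ : ∃ b, s = q + b := ⟨s - q, by omega⟩
        rw [comparison_cls (a + b) (by omega), comparison_cls a (by omega),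
          comparison_cls b (by omega), singularCochains.mul_incl rfl, cupAt_rfl,
          integrateAt_shuffle_eq_cup, map_smul, smul_smul]
        convert one_smul k _
        -- The Koszul exponent is `q * a`, so its sign cancels that of the concatenation.
        have h1 : (q : ℤ) * (((p + a : ℕ) : ℤ) - p) = ((q * a : ℕ) : ℤ) := by push_cast; ring
        rw [h1, Int.cast_negOnePow_natCast, ← mul_pow]
        simp

theorem isDGHom_comparison : IsDGHom (A := realization k Z)
    (B := singularCochains k (geometricRealization Z)) (comparison k Z) where
  map_deg := comparison_mem_deg
  map_d := comparison_d
  map_mul := comparison_mul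
  map_one := comparison_one

end Comparison

end BenderskyGitler

theorem proposition2 {k : Type v} [Field k] :
    (∀ Z : SimplexCategory ⥤ TopCat.{u},
      (BenderskyGitler.realization k Z).IsDGAlgebra ∧
      (BenderskyGitler.singularCochains k (BenderskyGitler.geometricRealization Z)).IsDGAlgebra ∧
      BenderskyGitler.IsDGHom (A := BenderskyGitler.realization k Z)
        (B := BenderskyGitler.singularCochains k (BenderskyGitler.geometricRealization Z))
        (BenderskyGitler.comparison k Z) ∧
      ∀ x, BenderskyGitler.comparison k Z x ∈
        BenderskyGitler.normalizedSingularCochains k (BenderskyGitler.geometricRealization Z)) ∧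
    ∀ (Z W : SimplexCategory ⥤ TopCat.{u}) (f : Z ⟶ W)
      (x : (BenderskyGitler.realization k W).carrier),
      BenderskyGitler.comparison k Z (BenderskyGitler.realization.map f x) =
        BenderskyGitler.singularCochains.map k (BenderskyGitler.geometricRealization.map f)
          (BenderskyGitler.comparison k W x) :=
  ⟨fun _ => ⟨BenderskyGitler.realization.isDGAlgebra, BenderskyGitler.singularCochains.isDGAlgebra,
    BenderskyGitler.isDGHom_comparison, BenderskyGitler.comparison_mem_normalized⟩,
    fun _ _ f x => BenderskyGitler.comparison_map f x⟩
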